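/- Let $n\ge 1$, let $\theta_j=\tfrac12(\cos(j\pi/n)-1)$, $0\le j\le n$, be the rescaled Chebyshev extremal nodes on $[-1,0]$, let $\ell_j$ be the Lagrange polynomials of these nodes, let $D=(\ell_j'(\theta_i))_{1\le i,j\le n}\in\mathbb R^{n\times n}$ and $\mathbf 1=(1,\dots,1)^T\in\mathbb R^n$. For $\alpha>0$ consider the pseudospectral approximation of Wright's equation $\dot x(t)=-\alpha x(t-1)(1+x(t))$, i.e. the ODE $$\frac{d}{dt}\begin{pmatrix}y_0\\ y\end{pmatrix}=\begin{pmatrix}-\alpha\, y^{(n)}(1+y_0)\\ Dy-y_0D\mathbf 1\end{pmatrix},\qquad (1)$$ where $y^{(n)}$ is the last component of $y$; we consider it on $\mathbb R\times\mathbb R^n$ and on the complexification $\mathbb C\times\mathbb C^n$. Let $A_n(y_0,y)=(-\alpha y^{(n)},\,Dy-y_0D\mathbf 1)$ be its linearization at $0$. Assume that $A_n$ has, counted with algebraic multiplicity, exactly two eigenvalues $\lambda_{n,+},\lambda_{n,-}$ in the open right half plane, and $\lambda_{n,+}\neq\lambda_{n,-}$; put $\lambda_n=(\lambda_{n,+},\lambda_{n,-})$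 and $\langle\lambda_n,\beta\rangle=\lambda_{n,+}\beta_1+\lambda_{n,-}\beta_2$ for $\beta\in\mathbb N^2$. Assume that $\langle\lambda_n,\beta\rangle\notin\sigma(D)$ for all $\beta\in\mathbb N^2$ with $|\beta|=\beta_1+\beta_2\ge1$. Fix constants $\xi_\beta\in\mathbb C\setminus\{0\}$ for $|\beta|=1$. For a complex sequence $x=(x_\beta)_{\beta\in\mathbb N^2}$ define $$F_n(x)_\beta=\begin{cases}x_\beta,&\beta=0,\\ x_\beta-\xi_\beta,&|\beta|=1,\\ \Delta_n(\langle\lambda_n,\beta\rangle)x_\beta+\alpha(x*r_n(x))_\beta,&|\beta|\ge2,\end{cases}$$ where $\Delta_n(\lambda)=\lambda+\alpha\big((D-\lambda I)^{-1}D\mathbf 1\big)_n$, $r_n(x)_\beta=x_\beta\big((D-\langle\lambda_n,\beta\rangle I)^{-1}D\mathbf 1\big)_n$ and $(x*y)_\beta=\sum_{\beta_1+\beta_2=\beta}x_{\beta_1}y_{\beta_2}$. Suppose that $p=(p_\beta)_{\beta\in\mathbb N^2}$ satisfies $F_n(p)=0$ and $\sum_\beta|p_\beta|<\infty$. Then the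 series $$P_n(\sigma)=\sum_{\beta\in\mathbb N^2}p_\beta\begin{pmatrix}1\\(D-\langle\lambda_n,\beta\rangle I)^{-1}D\mathbf 1\end{pmatrix}\sigma^\beta$$ converges absolutely for $|\sigma_1|,|\sigma_2|\le1$, and $P_n$ is a parametrization of a local unstable manifold of the origin of (1). More precisely, let $B\subset\mathbb C^2$ be the open unit polydisk or the open Euclidean unit ball. Then $P_n(0)=0$, $P_n$ is an analytic embedding of $B$ into $\mathbb C\times\mathbb C^n$, the range of $P_n'(0)$ is the unstable subspace of $A_n$, the image $P_n(B)$ is a local unstable manifold of the origin for (1) on $\mathbb C\times\mathbb C^n$, and $P_n(B)\cap(\mathbb R\times\mathbb R^n)$ is a local unstable manifold of the origin for (1) on $\mathbb R\times\mathbb R^n$. Here the unstable subspace is the sum of the generalized eigenspaces of $A_n$ for the eigenvalues with positive real part (in the real case: the real vectors in it). A set $M$ is a local unstable manifold of the origin if (i) for some open neighbourhood $U$ of $0$, $M$ is the set of all $y(0)$, where $y:(-\infty,0]\to U$ is a solution of (1) with $\|y(t)\|\le Ce^{\mu t}$ for all $t\le0$, for some $C$ and some $\mu>0$; and (ii) $M$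 is an embedded analytic submanifold (complex analytic, respectively real analytic) of the dimension of the unstable subspace, whose tangent space at $0$ is the unstable subspace. -/

import Mathlib

noncomputable section

/-! ## Unstable manifolds of an equilibrium at the origin -/

section UnstableManifold

/-- The unstable set of the equilibrium `0` of `x' = f x`, relative to `U`: all end points of
backward orbits that stay in `U` and tend to `0` at an exponential rate in backward time. -/
def localUnstableSet {E : Type*} [NormedAddCommGroup E] [NormedSpace ℝ E]
    (f : E → E) (U : Set E) : Set E :=
  {x | ∃ γ : ℝ → E, γ 0 = x ∧
    (∀ t ≤ 0, γ t ∈ U ∧ HasDerivWithinAt γ (f (γ t)) (Set.Iic 0) t) ∧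
    ∃ C : ℝ, ∃ μ > 0, ∀ t ≤ 0, ‖γ t‖ ≤ C * Real.exp (μ * t)}

/-- `φ`, restricted to the open set `V`, is an analytic embedding with image `M`. -/
structure IsAnalyticParametrization (𝕜 : Type*) [NontriviallyNormedField 𝕜]
    {F E : Type*} [NormedAddCommGroup F] [NormedSpace 𝕜 F]
    [NormedAddCommGroup E] [NormedSpace 𝕜 E] (φ : F → E) (V : Set F) (M : Set E) : Prop where
  isOpen : IsOpen V
  analytic : AnalyticOnNhd 𝕜 φ V
  immersion : ∀ v ∈ V, Function.Injective (fderiv 𝕜 φ v)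
  embedding : Topology.IsEmbedding (V.domRestrict φ)
  image_eq : φ '' V = M

/-- `M` is a local unstable manifold of the equilibrium `0` of `x' = f x`, where `Eu` is the
unstable subspace of the linearization at `0`: it is the unstable set relative to some open
neighbourhood of `0`, and it is an embedded `𝕜`-analytic submanifold modelled on `Eu` whose
tangent space at `0` is `Eu`. -/
def IsLocalUnstableManifold (𝕜 : Type*) [NontriviallyNormedField 𝕜]
    {E : Type*} [NormedAddCommGroup E] [NormedSpace ℝ E] [NormedSpace 𝕜 E]
    (f : E → E) (Eu : Submodule 𝕜 E) (M : Set E) : Prop :=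
  (∃ U : Set E, IsOpen U ∧ 0 ∈ U ∧ M = localUnstableSet f U) ∧
  ∀ x ∈ M, ∃ (W : Set E) (V : Set Eu) (φ : Eu → E) (v : Eu),
    IsOpen W ∧ x ∈ W ∧ v ∈ V ∧ φ v = x ∧ IsAnalyticParametrization 𝕜 φ V (M ∩ W) ∧
    (x = 0 → (fderiv 𝕜 φ v).range = Eu)

end UnstableManifold

/-! ## The pseudospectral approximation of Wright's equation -/

/-- The Chebyshev extremal nodes, rescaled to `[-1, 0]`. -/
def chebNode (n : ℕ) (j : Fin (n + 1)) : ℝ :=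
  (1 / 2) * (Real.cos ((j : ℝ) * Real.pi / n) - 1)

/-- The Lagrange polynomials of the nodes. -/
def lagrangePoly (n : ℕ) (j : Fin (n + 1)) : Polynomial ℝ :=
  ∏ m ∈ Finset.univ.erase j,
    (Polynomial.C (chebNode n j - chebNode n m)⁻¹ * (Polynomial.X - Polynomial.C (chebNode n m)))

/-- The differentiation matrix `D`, with entries `ℓ_j'(θ_i)`, `1 ≤ i, j ≤ n`. -/
def diffMatrix (n : ℕ) : Matrix (Fin n) (Fin n) ℝ :=
  Matrix.of fun i j => (lagrangePoly n j.succ).derivative.eval (chebNode n i.succ)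

/-- `D` as a matrix over `𝕜 = ℝ` or `𝕜 = ℂ`. -/
def diffMatrixOver (𝕜 : Type*) [RCLike 𝕜] (n : ℕ) : Matrix (Fin n) (Fin n) 𝕜 :=
  (diffMatrix n).map (algebraMap ℝ 𝕜)

/-- The vector `D 𝟏`. -/
def diffOne (𝕜 : Type*) [RCLike 𝕜] (n : ℕ) : Fin n → 𝕜 :=
  (diffMatrixOver 𝕜 n).mulVec (fun _ => 1)

/-- The index of the last component `y^{(n)}` of `y = (y_1, …, y_n)`. -/
def lastIdx (n : ℕ) [NeZero n] : Fin n := ⟨n - 1, Nat.sub_lt (NeZero.pos n) one_pos⟩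

/-- The vector field `(y_0, y) ↦ (-α y^{(n)} (1 + y_0), D y - y_0 D 𝟏)` on `𝕜 × 𝕜ⁿ`. -/
def wrightField (𝕜 : Type*) [RCLike 𝕜] (α : ℝ) (n : ℕ) [NeZero n]
    (y : 𝕜 × (Fin n → 𝕜)) : 𝕜 × (Fin n → 𝕜) :=
  (-(algebraMap ℝ 𝕜 α) * y.2 (lastIdx n) * (1 + y.1),
    (diffMatrixOver 𝕜 n).mulVec y.2 - y.1 • diffOne 𝕜 n)

/-- The linear map `A_n (y_0, y) = (-α y^{(n)}, D y - y_0 D 𝟏)` on `ℂ × ℂⁿ`. -/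
def wrightLin (α : ℝ) (n : ℕ) [NeZero n] :
    (ℂ × (Fin n → ℂ)) →ₗ[ℂ] (ℂ × (Fin n → ℂ)) where
  toFun y := (-(α : ℂ) * y.2 (lastIdx n),
    (diffMatrixOver ℂ n).mulVec y.2 - y.1 • diffOne ℂ n)
  map_add' x y := by
    ext i
    · simp [mul_add]
    · simp [Matrix.mulVec_add, add_mul]; ring
  map_smul' c x := by
    ext i
    · simp; ring
    · simp [Matrix.mulVec_smul]; ring

/-- The unstable subspace of `A_n` in `ℂ × ℂⁿ`: the sum of the generalized eigenspaces of the
eigenvalues in the open right half plane. -/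
def unstableSubspace (α : ℝ) (n : ℕ) [NeZero n] : Submodule ℂ (ℂ × (Fin n → ℂ)) :=
  ⨆ (μ : ℂ) (_ : 0 < μ.re), Module.End.maxGenEigenspace (wrightLin α n) μ

/-- The inclusion `ℝ × ℝⁿ → ℂ × ℂⁿ`. -/
def complexify (n : ℕ) : (ℝ × (Fin n → ℝ)) →ₗ[ℝ] (ℂ × (Fin n → ℂ)) where
  toFun y := ((y.1 : ℂ), fun i => (y.2 i : ℂ))
  map_add' x y := by ext i <;> simp
  map_smul' c x := by ext i <;> simp

/-- The unstable subspace of `A_n` in `ℝ × ℝⁿ`: the real vectors in the complex one. -/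
def realUnstableSubspace (α : ℝ) (n : ℕ) [NeZero n] : Submodule ℝ (ℝ × (Fin n → ℝ)) :=
  ((unstableSubspace α n).restrictScalars ℝ).comap (complexify n)

/-! ## The zero finding problem -/

/-- `⟨λ, β⟩ = λ₁ β₁ + λ₂ β₂`. -/
def pairing (l : ℂ × ℂ) (β : ℕ × ℕ) : ℂ := l.1 * (β.1 : ℂ) + l.2 * (β.2 : ℂ)

/-- The vector `(D - z I)⁻¹ D 𝟏`. -/
def blowup (n : ℕ) (z : ℂ) : Fin n → ℂ :=
  ((diffMatrixOver ℂ n - z • (1 : Matrix (Fin n) (Fin n) ℂ))⁻¹).mulVec (diffOne ℂ n)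

/-- `Δ_n(z) = z + α ((D - z I)⁻¹ D 𝟏)_n`. -/
def charFn (α : ℝ) (n : ℕ) [NeZero n] (z : ℂ) : ℂ := z + (α : ℂ) * blowup n z (lastIdx n)

/-- `r_n(x)_β = x_β ((D - ⟨λ, β⟩ I)⁻¹ D 𝟏)_n`. -/
def rOp (n : ℕ) [NeZero n] (l : ℂ × ℂ) (x : ℕ × ℕ → ℂ) : ℕ × ℕ → ℂ :=
  fun β => x β * blowup n (pairing l β) (lastIdx n)

/-- The convolution `(x * y)_β = ∑_{β₁ + β₂ = β} x_{β₁} y_{β₂}`. -/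
def conv (x y : ℕ × ℕ → ℂ) : ℕ × ℕ → ℂ :=
  fun β => ∑ b ∈ Finset.Iic β, x b * y (β - b)

/-- The map `F_n`. -/
def zeroMap (α : ℝ) (n : ℕ) [NeZero n] (l : ℂ × ℂ) (ξ : ℕ × ℕ → ℂ) (x : ℕ × ℕ → ℂ) :
    ℕ × ℕ → ℂ :=
  fun β =>
    if β.1 + β.2 = 0 then x β
    else if β.1 + β.2 = 1 then x β - ξ β
    else charFn α n (pairing l β) * x β + (α : ℂ) * conv x (rOp n l x) β

/-- The term `p_β σ^β (1, (D - ⟨λ, β⟩ I)⁻¹ D 𝟏)`. -/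
def paramTerm (n : ℕ) (l : ℂ × ℂ) (p : ℕ × ℕ → ℂ) (σ : ℂ × ℂ) (β : ℕ × ℕ) :
    ℂ × (Fin n → ℂ) :=
  (p β * (σ.1 ^ β.1 * σ.2 ^ β.2)) • ((1 : ℂ), blowup n (pairing l β))

/-- The map `P_n(σ) = ∑_β p_β (1, (D - ⟨λ, β⟩ I)⁻¹ D 𝟏) σ^β`. -/
def paramMap (n : ℕ) (l : ℂ × ℂ) (p : ℕ × ℕ → ℂ) (σ : ℂ × ℂ) : ℂ × (Fin n → ℂ) :=
  ∑' β : ℕ × ℕ, paramTerm n l p σ β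

/-- The open unit polydisk in `ℂ²`. -/
def polydisk : Set (ℂ × ℂ) := {σ | ‖σ.1‖ < 1 ∧ ‖σ.2‖ < 1}

/-- The open Euclidean unit ball in `ℂ²`. -/
def euclideanUnitBall : Set (ℂ × ℂ) := {σ | ‖σ.1‖ ^ 2 + ‖σ.2‖ ^ 2 < 1}

end

/-! Write (1) as `x' = A x + N x` with `N` quadratic. The condition `F_n(p) = 0` is the
coefficientwise form of the invariance equation `P'(σ)(Λσ) = A P(σ) + N P(σ)`, where `Λ` is diagonal
with entries `λ_{n,±}`: the second component holds term by term by the choice of `blowup`, the first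
is `coeff_recursion`. Hence `P` carries the linear flow `e^{tΛ}` to orbits of (1) (`invariance`,
`paramMap_solution`). The vectors `blowup` stay bounded as `|β| → ∞`, so the coefficients are
summable (`summable_paramCoeff`); `P` is analytic on the open polydisk and continuous on the closed
one. At `0` its derivative sends the two axes to nonzero multiples of the unstable eigenvectors.

No smallness of `ξ` is needed, because the backward flow shrinks the whole polydisk uniformly into
any neighbourhood of `0`. There `P` is antilipschitz by its injective derivative, and Grönwall
carries the estimate back to the full closed polydisk (`exists_antilipschitz`). This gives
immersion, embedding, and injectivity up to the boundary.

For the dynamical characterization take `U` to be the complement of `P(∂B)`. Orbits on `P(B)` avoid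
`P(∂B)` by injectivity. Conversely, let an orbit in `U` decay exponentially. Far back in time its
unstable component equals that of some `P(σ)`, and Lyapunov-Perron uniqueness
(`exists_lipschitz_imp_unique`) puts it on `P(B)`. Followed forward it could leave `P(B)` only
through `P(∂B)`, which `U` excludes. The unstable component is measured by `q(A)`, with `q` the
stable factor of the characteristic polynomial, in place of a spectral projection.

In the real case, conjugation commutes with the field and with `q(A)`. An orbit on the image that is
real once is real always, and near `0` a point `P(σ)` is real as soon as `q(A) P(σ)` is. So real
vectors of the unstable subspace serve as coordinates after flowing back by a fixed time. -/

noncomputable section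

/-! ## Exponentially decaying solutions of linear equations -/

section Decay

open Polynomial Set

set_option linter.unusedSectionVars false

variable {E : Type*} [NormedAddCommGroup E] [NormedSpace ℝ E] [NormedSpace ℂ E]
  [IsScalarTower ℝ ℂ E]

/-- A curve whose velocity is bounded by `H e^{at}` moves at most `(H/a) (e^{at} - e^{as})`. -/
lemma norm_sub_le_of_deriv_exp_bound {u u' : ℝ → E} {H a : ℝ} (ha : a ≠ 0)
    (hu : ∀ t ≤ 0, HasDerivWithinAt u (u' t) (Iic 0) t)
    (hb : ∀ t ≤ 0, ‖u' t‖ ≤ H * Real.exp (a * t)) {s t : ℝ} (hst : s ≤ t) (ht : t ≤ 0) :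
    ‖u t - u s‖ ≤ H / a * (Real.exp (a * t) - Real.exp (a * s)) := by
  have hB : ∀ x, HasDerivAt (fun x => H / a * (Real.exp (a * x) - Real.exp (a * s)))
      (H * Real.exp (a * x)) x := by
    intro x
    have h1 : HasDerivAt (fun x : ℝ => a * x) a x := by
      simpa using (hasDerivAt_id x).const_mul a
    have h2 := (h1.exp.sub_const (Real.exp (a * s))).const_mul (H / a)
    exact h2.congr_deriv (by rw [← mul_assoc, mul_comm (H / a), mul_assoc,
      div_mul_cancel₀ _ ha, mul_comm])
  refine image_norm_le_of_norm_deriv_right_le_deriv_boundary (a := s) (b := t)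
    (f := fun x => u x - u s) (f' := u') ?_ ?_ ?_ hB ?_ ⟨hst, le_rfl⟩
  · intro x hx
    exact ((hu x (hx.2.trans ht)).continuousWithinAt.mono
      (fun y hy => hy.2.trans ht)).sub continuousWithinAt_const
  · intro x hx
    have hx0 : x < 0 := hx.2.trans_le ht
    have := (hu x hx0.le).hasDerivAt (Iic_mem_nhds hx0)
    exact (this.sub_const (u s)).hasDerivWithinAt
  · simp
  · intro x hx
    exact hb x (hx.2.le.trans ht)

/-- The integrating factor `e^{-νt}` removes the linear term, so that
`norm_sub_le_of_deriv_exp_bound` applies to the weighted curve. -/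
lemma hasDerivWithinAt_exp_smul {ν : ℂ} {w h : ℝ → E} {t : ℝ}
    (hw : HasDerivWithinAt w (ν • w t + h t) (Iic 0) t) :
    HasDerivWithinAt (fun t : ℝ => Complex.exp (-ν * t) • w t)
      (Complex.exp (-ν * t) • h t) (Iic 0) t := by
  have h1 : HasDerivAt (fun t : ℝ => -ν * (t : ℂ)) (-ν) t := by
    simpa using (Complex.ofRealCLM.hasDerivAt (x := t)).const_mul (-ν)
  have h2 := h1.cexp.hasDerivWithinAt (s := Iic 0)
  have h3 := h2.smul hw
  refine h3.congr_deriv ?_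
  rw [smul_add, smul_smul, add_right_comm, ← add_smul]
  ring_nf
  simp

lemma norm_exp_neg_mul (ν : ℂ) (t : ℝ) :
    ‖Complex.exp (-ν * t)‖ = Real.exp (-ν.re * t) := by
  rw [Complex.norm_exp]; simp

lemma exp_bound_of_smul {w : ℝ → E} {ν : ℂ} {t a K μ : ℝ} (ha : a = μ - ν.re)
    (h : ‖Complex.exp (-ν * t) • w t‖ ≤ K * Real.exp (a * t)) :
    ‖w t‖ ≤ K * Real.exp (μ * t) := by
  rw [norm_smul, norm_exp_neg_mul] at h
  have h0 : Real.exp (ν.re * t) * Real.exp (-ν.re * t) = 1 := by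
    rw [← Real.exp_add]; ring_nf; simp
  calc ‖w t‖ = Real.exp (ν.re * t) * (Real.exp (-ν.re * t) * ‖w t‖) := by
        rw [← mul_assoc, h0, one_mul]
    _ ≤ Real.exp (ν.re * t) * (K * Real.exp (a * t)) := by gcongr
    _ = K * (Real.exp (ν.re * t) * Real.exp (a * t)) := by ring
    _ = K * Real.exp (μ * t) := by rw [← Real.exp_add, ha]; ring_nf

/-- Decaying solutions of `w' = ν w + h` for `ν` outside the right half plane. -/
lemma norm_le_of_stable {w h : ℝ → E} {ν : ℂ} {μ C H : ℝ} (hμ : 0 < μ) (hν : ν.re ≤ 0)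
    (hH : 0 ≤ H)
    (hw : ∀ t ≤ 0, HasDerivWithinAt w (ν • w t + h t) (Iic 0) t)
    (hC : ∀ t ≤ 0, ‖w t‖ ≤ C * Real.exp (μ * t))
    (hh : ∀ t ≤ 0, ‖h t‖ ≤ H * Real.exp (μ * t)) (t : ℝ) (ht : t ≤ 0) :
    ‖w t‖ ≤ H / μ * Real.exp (μ * t) := by
  have ha : 0 < μ - ν.re := by linarith
  have key : ‖Complex.exp (-ν * t) • w t‖ ≤ H / (μ - ν.re) * Real.exp ((μ - ν.re) * t) := by
    -- Integrate from `s` to `t`. The weighted curve at `s` decays at the rate `μ - Re ν > 0`, so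
    -- letting `s → -∞` removes the a priori constant `C`.
    have h1 : ∀ s ≤ t, ‖Complex.exp (-ν * t) • w t‖ ≤
        H / (μ - ν.re) * Real.exp ((μ - ν.re) * t) + C * Real.exp ((μ - ν.re) * s) := by
      intro s hs
      have h2 := norm_sub_le_of_deriv_exp_bound (H := H) ha.ne'
        (fun t ht => hasDerivWithinAt_exp_smul (hw t ht)) (fun t ht => by
          rw [norm_smul, norm_exp_neg_mul, sub_mul, sub_eq_add_neg, Real.exp_add, ← neg_mul,
            mul_comm (Real.exp (μ * t)), mul_left_comm]
          gcongr
          exact hh t ht) hs ht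
      have h3 : ‖Complex.exp (-ν * s) • w s‖ ≤ C * Real.exp ((μ - ν.re) * s) := by
        rw [norm_smul, norm_exp_neg_mul, sub_mul, sub_eq_add_neg, Real.exp_add, ← neg_mul,
            mul_comm (Real.exp (μ * s)), mul_left_comm]
        gcongr
        exact hC s (hs.trans ht)
      have h4 := norm_le_norm_add_norm_sub' (Complex.exp (-ν * t) • w t)
        (Complex.exp (-ν * s) • w s)
      have h5 : 0 ≤ H / (μ - ν.re) * Real.exp ((μ - ν.re) * s) := by positivity
      rw [mul_sub] at h2
      linarith
    have h6 : Filter.Tendsto (fun s : ℝ => H / (μ - ν.re) * Real.exp ((μ - ν.re) * t) +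
        C * Real.exp ((μ - ν.re) * s)) Filter.atBot
        (nhds (H / (μ - ν.re) * Real.exp ((μ - ν.re) * t) + C * 0)) := by
      refine tendsto_const_nhds.add (Filter.Tendsto.const_mul _ ?_)
      exact Real.tendsto_exp_atBot.comp (Filter.tendsto_id.const_mul_atBot ha)
    rw [mul_zero, add_zero] at h6
    exact ge_of_tendsto h6 ((Filter.eventually_le_atBot t).mono h1)
  have := exp_bound_of_smul rfl key
  refine this.trans ?_
  gcongr
  linarith

/-- Solutions of `w' = ν w + h` vanishing at `0`, for `ν` in the right half plane. -/
lemma norm_le_of_unstable {w h : ℝ → E} {ν : ℂ} {μ H : ℝ} (hν : μ < ν.re)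
    (hH : 0 ≤ H)
    (hw : ∀ t ≤ 0, HasDerivWithinAt w (ν • w t + h t) (Iic 0) t)
    (h0 : w 0 = 0)
    (hh : ∀ t ≤ 0, ‖h t‖ ≤ H * Real.exp (μ * t)) (t : ℝ) (ht : t ≤ 0) :
    ‖w t‖ ≤ H / (ν.re - μ) * Real.exp (μ * t) := by
  have ha : 0 < ν.re - μ := by linarith
  refine exp_bound_of_smul (ν := ν) (a := μ - ν.re) rfl ?_
  -- Integrate from `t` up to `0`, where `w` vanishes. The rate `μ - Re ν` is negative, so the
  -- contribution of the endpoint `0` has a favourable sign and is dropped.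
  have h2 := norm_sub_le_of_deriv_exp_bound (H := H) (a := μ - ν.re) (by linarith)
    (fun t ht => hasDerivWithinAt_exp_smul (hw t ht)) (fun t ht => by
      rw [norm_smul, norm_exp_neg_mul, sub_mul, sub_eq_add_neg, Real.exp_add, ← neg_mul,
        mul_comm (Real.exp (μ * t)), mul_left_comm]
      gcongr
      exact hh t ht) ht le_rfl
  rw [h0, smul_zero, zero_sub, norm_neg] at h2
  refine h2.trans ?_
  have h3 : 0 ≤ H / (ν.re - μ) := by positivity
  have h4 : H / (μ - ν.re) = - (H / (ν.re - μ)) := by rw [← neg_sub, div_neg]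
  rw [h4]
  simp only [mul_zero, Real.exp_zero]
  nlinarith [Real.exp_pos ((μ - ν.re) * t)]

lemma aeval_X_sub_C_apply (A : E →L[ℂ] E) (ν : ℂ) (x : E) :
    aeval A (X - C ν) x = A x - ν • x := by
  simp [Algebra.algebraMap_eq_smul_one]

lemma aeval_apply_comm (A : E →L[ℂ] E) (q : ℂ[X]) (x : E) :
    aeval A q (A x) = A (aeval A q x) := by
  have : aeval A (q * X) = aeval A (X * q) := by rw [mul_comm]
  simpa using congrArg (fun B : E →L[ℂ] E => B x) this

/-- If `w` solves `w' = A w + h`, then `q(A) w` solves `v' = A v + q(A) h`. -/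
lemma hasDerivWithinAt_aeval {A : E →L[ℂ] E} (q : ℂ[X]) {w h : ℝ → E} {t : ℝ}
    (hw : HasDerivWithinAt w (A (w t) + h t) (Iic 0) t) :
    HasDerivWithinAt (fun t => aeval A q (w t)) (A (aeval A q (w t)) + aeval A q (h t))
      (Iic 0) t := by
  have := ((aeval A q).restrictScalars ℝ).hasFDerivAt.comp_hasDerivWithinAt t hw
  refine this.congr_deriv ?_
  simp [aeval_apply_comm]

/-- Decaying solutions of `w' = A w + h` are controlled by `h` and `q(A) w` if all roots of `q`
lie outside the right half plane. -/
lemma exists_bound_of_stable (A : E →L[ℂ] E) {μ : ℝ} (hμ : 0 < μ) (s : Multiset ℂ) :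
    (∀ ν ∈ s, ν.re ≤ 0) → ∃ K, 0 ≤ K ∧ ∀ (w h : ℝ → E) (C' H : ℝ), 0 ≤ H →
      (∀ t ≤ 0, HasDerivWithinAt w (A (w t) + h t) (Iic 0) t) →
      (∀ t ≤ 0, ‖w t‖ ≤ C' * Real.exp (μ * t)) →
      (∀ t ≤ 0, ‖h t‖ ≤ H * Real.exp (μ * t)) →
      (∀ t ≤ 0, ‖aeval A (s.map (fun ν => X - C ν)).prod (w t)‖ ≤ H * Real.exp (μ * t)) →
      ∀ t ≤ 0, ‖w t‖ ≤ K * H * Real.exp (μ * t) := by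
  induction s using Multiset.induction with
  | empty =>
    intro _
    refine ⟨1, zero_le_one, ?_⟩
    intro w h C' H hH hw hC hh hq t ht
    simpa using hq t ht
  | cons ν s ih =>
    intro hs
    obtain ⟨K, hK, ih⟩ := ih fun ν' h => hs ν' (Multiset.mem_cons_of_mem h)
    set B : E →L[ℂ] E := aeval A (X - C ν) with hB
    set M := max 1 ‖B‖ with hM
    have hM1 : 1 ≤ M := le_max_left _ _
    have hMB : ‖B‖ ≤ M := le_max_right _ _
    refine ⟨(K * M + 1) / μ, by positivity, ?_⟩
    intro w h C' H hH hw hC hh hq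
    -- With `B = A - ν`, the curve solves `w' = ν w + (B w + h)`. Induction bounds `B w`, because
    -- the remaining factors applied to `B w` give `q(A) w`; `M ≥ 1` lets `M * H` dominate both
    -- data.
    have hb : ∀ t ≤ 0, ‖B (w t)‖ ≤ K * (M * H) * Real.exp (μ * t) := by
      refine ih (fun t => B (w t)) (fun t => B (h t)) (‖B‖ * C') (M * H) (by positivity)
        (fun t ht => hasDerivWithinAt_aeval _ (hw t ht)) ?_ ?_ ?_
      · intro t ht
        calc ‖B (w t)‖ ≤ ‖B‖ * ‖w t‖ := B.le_opNorm _
          _ ≤ ‖B‖ * (C' * Real.exp (μ * t)) := by gcongr; exact hC t ht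
          _ = _ := by ring
      · intro t ht
        calc ‖B (h t)‖ ≤ ‖B‖ * ‖h t‖ := B.le_opNorm _
          _ ≤ M * (H * Real.exp (μ * t)) := by gcongr; exact hh t ht
          _ = _ := by ring
      · intro t ht
        have h1 := hq t ht
        rw [Multiset.map_cons, Multiset.prod_cons, mul_comm, map_mul] at h1
        refine h1.trans ?_
        gcongr
        nlinarith
    intro t ht
    have := norm_le_of_stable (w := w) (h := fun t => B (w t) + h t) (ν := ν)
      (H := (K * M + 1) * H) hμ (hs ν (Multiset.mem_cons_self _ _)) (by positivity)
      (fun t ht => by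
        convert hw t ht using 1
        rw [hB, aeval_X_sub_C_apply]; abel) hC (fun t ht => by
        calc ‖B (w t) + h t‖ ≤ ‖B (w t)‖ + ‖h t‖ := norm_add_le _ _
          _ ≤ K * (M * H) * Real.exp (μ * t) + H * Real.exp (μ * t) :=
            add_le_add (hb t ht) (hh t ht)
          _ = _ := by ring) t ht
    convert this using 2
    ring

/-- The Lyapunov-Perron estimate: decaying solutions of `w' = A w + h` without unstable
component at time `0` are controlled by `h`. -/
lemma exists_bound_lyapunov_perron (A : E →L[ℂ] E) {μ : ℝ} (hμ : 0 < μ) (s : Multiset ℂ)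
    (hs : ∀ ν ∈ s, ν.re ≤ 0) {l₁ l₂ : ℂ} (h₁ : μ < l₁.re) (h₂ : μ < l₂.re)
    (hA : aeval A ((X - C l₁) * (X - C l₂) * (s.map (fun ν => X - C ν)).prod) = 0) :
    ∃ K, 0 ≤ K ∧ ∀ (w h : ℝ → E) (C' H : ℝ), 0 ≤ H →
      (∀ t ≤ 0, HasDerivWithinAt w (A (w t) + h t) (Iic 0) t) →
      (∀ t ≤ 0, ‖w t‖ ≤ C' * Real.exp (μ * t)) →
      (∀ t ≤ 0, ‖h t‖ ≤ H * Real.exp (μ * t)) →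
      aeval A (s.map (fun ν => X - C ν)).prod (w 0) = 0 →
      ∀ t ≤ 0, ‖w t‖ ≤ K * H * Real.exp (μ * t) := by
  obtain ⟨K, hK, hKb⟩ := exists_bound_of_stable A hμ s hs
  set q := (s.map (fun ν => X - C ν)).prod with hq
  set Q : E →L[ℂ] E := aeval A q with hQ
  set R : E →L[ℂ] E := aeval A (X - C l₁) with hR
  set M₁ := ‖R‖ * ‖Q‖ / (l₂.re - μ) with hM₁
  set M₂ := (M₁ + ‖Q‖) / (l₁.re - μ) with hM₂
  have hl₁ : 0 < l₁.re - μ := by linarith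
  have hl₂ : 0 < l₂.re - μ := by linarith
  have hM₁0 : 0 ≤ M₁ := by positivity
  have hM₂0 : 0 ≤ M₂ := by positivity
  refine ⟨K * (1 + M₂), by positivity, ?_⟩
  intro w h C' H hH hw hC hh h0
  have hQh : ∀ t ≤ 0, ‖Q (h t)‖ ≤ ‖Q‖ * H * Real.exp (μ * t) := fun t ht =>
    calc ‖Q (h t)‖ ≤ ‖Q‖ * ‖h t‖ := Q.le_opNorm _
      _ ≤ ‖Q‖ * (H * Real.exp (μ * t)) := by gcongr; exact hh t ht
      _ = _ := by ring
  have hRQh : ∀ t ≤ 0, ‖R (Q (h t))‖ ≤ ‖R‖ * ‖Q‖ * H * Real.exp (μ * t) := fun t ht =>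
    calc ‖R (Q (h t))‖ ≤ ‖R‖ * ‖Q (h t)‖ := R.le_opNorm _
      _ ≤ ‖R‖ * (‖Q‖ * H * Real.exp (μ * t)) := by gcongr; exact hQh t ht
      _ = _ := by ring
  have hdQ : ∀ t ≤ 0, HasDerivWithinAt (fun t => Q (w t)) (A (Q (w t)) + Q (h t)) (Iic 0) t :=
    fun t ht => hasDerivWithinAt_aeval q (hw t ht)
  -- `A - l₂` kills the range of `R Q`. Hence `R Q w` solves a scalar equation with exponent `l₂`,
  -- and `Q w` one with exponent `l₁` forced by `R Q w`; both vanish at time `0`.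
  have hA' : ∀ x, A (R (Q x)) = l₂ • R (Q x) := by
    intro x
    have h1 : aeval A ((X - C l₂) * ((X - C l₁) * q)) = 0 := by rw [← hA]; ring_nf
    have h2 := congrArg (fun B : E →L[ℂ] E => B x) h1
    simp only [map_mul] at h2
    rw [mul_apply_eq_comp, aeval_X_sub_C_apply] at h2
    exact sub_eq_zero.1 h2
  have hRb : ∀ t ≤ 0, ‖R (Q (w t))‖ ≤ M₁ * H * Real.exp (μ * t) := by
    intro t ht
    have := norm_le_of_unstable (w := fun t => R (Q (w t))) (h := fun t => R (Q (h t))) (ν := l₂)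
      (H := ‖R‖ * ‖Q‖ * H) h₂ (by positivity)
      (fun t ht => by
        rw [← hA']
        exact hasDerivWithinAt_aeval (h := fun t => Q (h t)) _ (hdQ t ht)) (by simp [h0]) hRQh t ht
    convert this using 2
    ring
  have hQb : ∀ t ≤ 0, ‖Q (w t)‖ ≤ M₂ * H * Real.exp (μ * t) := by
    intro t ht
    have := norm_le_of_unstable (w := fun t => Q (w t)) (h := fun t => R (Q (w t)) + Q (h t))
      (ν := l₁) (H := (M₁ + ‖Q‖) * H) h₁ (by positivity)
      (fun t ht => by
        convert hdQ t ht using 1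
        rw [hR, aeval_X_sub_C_apply]; abel) h0 (fun t ht => by
        calc ‖R (Q (w t)) + Q (h t)‖ ≤ ‖R (Q (w t))‖ + ‖Q (h t)‖ := norm_add_le _ _
          _ ≤ M₁ * H * Real.exp (μ * t) + ‖Q‖ * H * Real.exp (μ * t) :=
            add_le_add (hRb t ht) (hQh t ht)
          _ = _ := by ring) t ht
    convert this using 2
    ring
  intro t ht
  have := hKb w h C' ((1 + M₂) * H) (by positivity) hw hC (fun t ht => (hh t ht).trans (by
    gcongr; nlinarith)) (fun t ht => (hQb t ht).trans (by gcongr; nlinarith)) t ht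
  convert this using 2
  ring

/-- Two solutions of `x' = A x + N x` that decay exponentially, stay where `N` is nearly
constant, and have the same unstable component at time `0`, coincide. -/
lemma exists_lipschitz_imp_unique (A : E →L[ℂ] E) {μ : ℝ} (hμ : 0 < μ) (s : Multiset ℂ)
    (hs : ∀ ν ∈ s, ν.re ≤ 0) {l₁ l₂ : ℂ} (h₁ : μ < l₁.re) (h₂ : μ < l₂.re)
    (hA : aeval A ((X - C l₁) * (X - C l₂) * (s.map (fun ν => X - C ν)).prod) = 0) :
    ∃ ε > 0, ∀ (N : E → E) (γ₁ γ₂ : ℝ → E) (C₁ C₂ : ℝ),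
      (∀ t ≤ 0, ‖N (γ₁ t) - N (γ₂ t)‖ ≤ ε * ‖γ₁ t - γ₂ t‖) →
      (∀ t ≤ 0, HasDerivWithinAt γ₁ (A (γ₁ t) + N (γ₁ t)) (Iic 0) t) →
      (∀ t ≤ 0, HasDerivWithinAt γ₂ (A (γ₂ t) + N (γ₂ t)) (Iic 0) t) →
      (∀ t ≤ 0, ‖γ₁ t‖ ≤ C₁ * Real.exp (μ * t)) →
      (∀ t ≤ 0, ‖γ₂ t‖ ≤ C₂ * Real.exp (μ * t)) →
      aeval A (s.map (fun ν => X - C ν)).prod (γ₁ 0) =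
        aeval A (s.map (fun ν => X - C ν)).prod (γ₂ 0) →
      ∀ t ≤ 0, γ₁ t = γ₂ t := by
  obtain ⟨K, hK, hKb⟩ := exists_bound_lyapunov_perron A hμ s hs h₁ h₂ hA
  -- Chosen so that `K ε ≤ 1/2`: each use of the Lyapunov-Perron bound on the difference halves its
  -- weighted norm.
  refine ⟨1 / (2 * (K + 1)), by positivity, ?_⟩
  intro N γ₁ γ₂ C₁ C₂ hN hγ₁ hγ₂ hC₁ hC₂ h0
  have hC0 : 0 ≤ C₁ + C₂ := by
    have h1 := (norm_nonneg _).trans (hC₁ 0 le_rfl)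
    have h2 := (norm_nonneg _).trans (hC₂ 0 le_rfl)
    simp at h1 h2
    linarith
  have key : ∀ k : ℕ, ∀ t ≤ 0, ‖γ₁ t - γ₂ t‖ ≤ (C₁ + C₂) * (1 / 2) ^ k * Real.exp (μ * t) := by
    intro k
    induction k with
    | zero =>
      intro t ht
      have := norm_sub_le (γ₁ t) (γ₂ t)
      have h1 := hC₁ t ht
      have h2 := hC₂ t ht
      rw [pow_zero, mul_one, add_mul]
      linarith
    | succ k ih =>
      intro t ht
      have := hKb (fun t => γ₁ t - γ₂ t) (fun t => N (γ₁ t) - N (γ₂ t))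
        ((C₁ + C₂) * (1 / 2) ^ k) (1 / (2 * (K + 1)) * ((C₁ + C₂) * (1 / 2) ^ k))
        (by positivity) (fun t ht => by
          refine ((hγ₁ t ht).sub (hγ₂ t ht)).congr_deriv ?_
          rw [map_sub]; abel) ih (fun t ht => (hN t ht).trans (by
            rw [mul_assoc]; gcongr; exact ih t ht)) (by rw [map_sub, h0, sub_self]) t ht
      refine this.trans ?_
      gcongr ?_ * _
      have h3 : K * (1 / (2 * (K + 1))) ≤ 1 / 2 := by
        rw [mul_one_div, div_le_div_iff₀ (by positivity) (by positivity)]; linarith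
      calc K * (1 / (2 * (K + 1)) * ((C₁ + C₂) * (1 / 2) ^ k))
          = K * (1 / (2 * (K + 1))) * ((C₁ + C₂) * (1 / 2) ^ k) := by ring
        _ ≤ 1 / 2 * ((C₁ + C₂) * (1 / 2) ^ k) := by gcongr
        _ = _ := by ring
  intro t ht
  have h1 : Filter.Tendsto (fun k : ℕ => (C₁ + C₂) * (1 / 2 : ℝ) ^ k * Real.exp (μ * t))
      Filter.atTop (nhds ((C₁ + C₂) * 0 * Real.exp (μ * t))) :=
    ((tendsto_pow_atTop_nhds_zero_of_lt_one (by norm_num) (by norm_num)).const_mul _).mul_const _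
  have h2 := ge_of_tendsto' h1 (fun k => key k t ht)
  rw [mul_zero, zero_mul] at h2
  exact sub_eq_zero.1 (norm_le_zero_iff.1 h2)

/-! ### Grönwall estimates and time shifts. -/

/-- Backward and forward dependence of bounded solutions on their values. -/
lemma norm_sub_le_of_solutions {f : E → E} {K : NNReal} {S : Set E} (hf : LipschitzOnWith K f S)
    {γ₁ γ₂ : ℝ → E} (h₁ : ∀ t ≤ 0, γ₁ t ∈ S ∧ HasDerivWithinAt γ₁ (f (γ₁ t)) (Iic 0) t)
    (h₂ : ∀ t ≤ 0, γ₂ t ∈ S ∧ HasDerivWithinAt γ₂ (f (γ₂ t)) (Iic 0) t)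
    {s t : ℝ} (hs : s ≤ 0) (ht : t ≤ 0) :
    ‖γ₁ t - γ₂ t‖ ≤ ‖γ₁ s - γ₂ s‖ * Real.exp (K * |t - s|) := by
  rcases le_total s t with hst | hst
  · have := dist_le_of_trajectories_ODE_of_mem (v := fun _ => f) (s := fun _ => S) (K := K)
      (f := γ₁) (g := γ₂) (a := s) (b := t) (δ := ‖γ₁ s - γ₂ s‖) (fun _ _ => hf)
      (fun x hx => (h₁ x (hx.2.trans ht)).2.continuousWithinAt.mono
        (fun y hy => hy.2.trans ht))
      (fun x hx => (((h₁ x (hx.2.le.trans ht)).2.hasDerivAt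
        (Iic_mem_nhds (hx.2.trans_le ht)))).hasDerivWithinAt)
      (fun x hx => (h₁ x (hx.2.le.trans ht)).1)
      (fun x hx => (h₂ x (hx.2.trans ht)).2.continuousWithinAt.mono
        (fun y hy => hy.2.trans ht))
      (fun x hx => (((h₂ x (hx.2.le.trans ht)).2.hasDerivAt
        (Iic_mem_nhds (hx.2.trans_le ht)))).hasDerivWithinAt)
      (fun x hx => (h₂ x (hx.2.le.trans ht)).1)
      (dist_eq_norm _ _).le t ⟨hst, le_rfl⟩
    rwa [dist_eq_norm, ← abs_of_nonneg (sub_nonneg.2 hst)] at this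
  -- For `t ≤ s` Grönwall is applied to the time-reversed curves, which solve `x' = -f x`.
  · have hneg : ∀ {γ : ℝ → E}, (∀ t ≤ 0, γ t ∈ S ∧ HasDerivWithinAt γ (f (γ t)) (Iic 0) t) →
        ∀ x, -s ≤ x → HasDerivWithinAt (fun x => γ (-x)) (- f (γ (-x))) (Ici x) x := by
      intro γ h x hx
      have h1 : HasDerivWithinAt γ (f (γ (-x))) (Iic 0) (-x) := (h (-x) (by linarith)).2
      have h2 : HasDerivWithinAt (fun x : ℝ => -x) (-1) (Ici x) x :=
        (hasDerivAt_neg x).hasDerivWithinAt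
      have h3 := h1.scomp x h2 (fun y hy => by
        have : x ≤ y := hy
        simp only [mem_Iic]; linarith)
      exact h3.congr_deriv (by simp)
    have hcont : ∀ {γ : ℝ → E}, (∀ t ≤ 0, γ t ∈ S ∧ HasDerivWithinAt γ (f (γ t)) (Iic 0) t) →
        ContinuousOn (fun x => γ (-x)) (Icc (-s) (-t)) := by
      intro γ h
      have hc : ContinuousOn γ (Iic 0) := fun x hx => (h x hx).2.continuousWithinAt
      exact hc.comp continuous_neg.continuousOn (fun x hx => by
        simp only [mem_Iic]; linarith [hx.1])
    have := dist_le_of_trajectories_ODE_of_mem (v := fun _ x => - f x) (s := fun _ => S) (K := K)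
      (f := fun x => γ₁ (-x)) (g := fun x => γ₂ (-x)) (a := -s) (b := -t)
      (δ := ‖γ₁ s - γ₂ s‖) (fun _ _ => hf.neg) (hcont h₁) (fun x hx => hneg h₁ x hx.1)
      (fun x hx => (h₁ (-x) (by linarith [hx.1])).1)
      (hcont h₂) (fun x hx => hneg h₂ x hx.1)
      (fun x hx => (h₂ (-x) (by linarith [hx.1])).1)
      (by simp [dist_eq_norm]) (-t) ⟨by linarith, le_rfl⟩
    rw [abs_of_nonpos (sub_nonpos.2 hst)]
    convert this using 2
    · simp [dist_eq_norm]
    · ring_nf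

lemma hasDerivWithinAt_shift {γ : ℝ → E} {F : E → E}
    (hγ : ∀ t ≤ 0, HasDerivWithinAt γ (F (γ t)) (Iic 0) t) {a : ℝ} (ha : a ≤ 0) :
    ∀ t ≤ 0, HasDerivWithinAt (fun t => γ (t + a)) (F (γ (t + a))) (Iic 0) t := by
  intro t ht
  have h1 : HasDerivWithinAt γ (F (γ (t + a))) (Iic 0) (t + a) := hγ _ (by linarith)
  have h2 : HasDerivWithinAt (fun x : ℝ => x + a) 1 (Iic 0) t :=
    ((hasDerivAt_id t).add_const a).hasDerivWithinAt
  exact (h1.scomp t h2 (fun y hy => by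
    have : y ≤ 0 := hy
    simp only [mem_Iic]; linarith)).congr_deriv (one_smul _ _)

end Decay

/-! ## Parametrizations of unstable manifolds with two simple unstable eigenvalues -/

section Parametrization

open Polynomial Set Metric

set_option linter.unusedSectionVars false

/-- The flow of the linear system `σ₁' = l₁ σ₁`, `σ₂' = l₂ σ₂`. -/
def linFlow (l : ℂ × ℂ) (t : ℝ) : (ℂ × ℂ) →L[ℂ] (ℂ × ℂ) :=
  (Complex.exp (l.1 * t) • ContinuousLinearMap.fst ℂ ℂ ℂ).prod
    (Complex.exp (l.2 * t) • ContinuousLinearMap.snd ℂ ℂ ℂ)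

lemma linFlow_apply (l : ℂ × ℂ) (t : ℝ) (σ : ℂ × ℂ) :
    linFlow l t σ = (Complex.exp (l.1 * t) * σ.1, Complex.exp (l.2 * t) * σ.2) := rfl

@[simp] lemma linFlow_zero (l : ℂ × ℂ) (σ : ℂ × ℂ) : linFlow l 0 σ = σ := by
  simp [linFlow_apply]

lemma linFlow_linFlow (l : ℂ × ℂ) (s t : ℝ) (σ : ℂ × ℂ) :
    linFlow l s (linFlow l t σ) = linFlow l (s + t) σ := by
  simp only [linFlow_apply, ← mul_assoc, ← Complex.exp_add]
  push_cast
  simp only [mul_add]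

lemma continuous_linFlow (l : ℂ × ℂ) (σ : ℂ × ℂ) : Continuous fun t => linFlow l t σ := by
  simp only [linFlow_apply]
  fun_prop

lemma norm_linFlow_le {l : ℂ × ℂ} {m : ℝ} (h₁ : m ≤ l.1.re) (h₂ : m ≤ l.2.re) {t : ℝ}
    (ht : t ≤ 0) (σ : ℂ × ℂ) : ‖linFlow l t σ‖ ≤ Real.exp (m * t) * ‖σ‖ := by
  have key : ∀ {z : ℂ} (x : ℂ), m ≤ z.re →
      ‖Complex.exp (z * t) * x‖ ≤ Real.exp (m * t) * ‖x‖ := by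
    intro z x hz
    rw [norm_mul, Complex.norm_exp]
    gcongr
    simp only [Complex.mul_re, Complex.ofReal_re, Complex.ofReal_im, mul_zero, sub_zero]
    nlinarith
  rw [linFlow_apply, Prod.norm_def]
  refine max_le ((key _ h₁).trans ?_) ((key _ h₂).trans ?_)
  · gcongr; exact norm_fst_le σ
  · gcongr; exact norm_snd_le σ

variable {E : Type*} [NormedAddCommGroup E] [NormedSpace ℝ E] [NormedSpace ℂ E]
  [IsScalarTower ℝ ℂ E]

/-- `P` maps the linear flow with exponents `l` to backward orbits of `x' = A x + N x`. Here `Eu`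
is the unstable subspace of `A`, whose unstable eigenvalues are `l.1` and `l.2`, and `s` is the
multiset of the other eigenvalues. -/
structure IsUnstableParam (A : E →L[ℂ] E) (N : E → E) (l : ℂ × ℂ) (s : Multiset ℂ)
    (Eu : Submodule ℂ E) (P : ℂ × ℂ → E) : Prop where
  re_fst_pos : 0 < l.1.re
  re_snd_pos : 0 < l.2.re
  re_nonpos : ∀ ν ∈ s, ν.re ≤ 0
  aeval_eq_zero : aeval A ((X - C l.1) * (X - C l.2) * (s.map (fun ν => X - C ν)).prod) = 0
  -- This and the next field let `q(A)` replace the spectral projection: it maps into `Eu`, is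
  -- injective there, and commutes with `A`.
  aeval_mem : ∀ x, aeval A (s.map (fun ν => X - C ν)).prod x ∈ Eu
  aeval_inj : ∀ x ∈ Eu, aeval A (s.map (fun ν => X - C ν)).prod x = 0 → x = 0
  nonlin : ∃ κ, 0 ≤ κ ∧ ∀ x y, ‖N x - N y‖ ≤ κ * (‖x‖ + ‖y‖) * ‖x - y‖
  analytic : AnalyticOnNhd ℂ P (ball 0 1)
  continuousOn : ContinuousOn P (closedBall 0 1)
  bound : ∃ C, 0 ≤ C ∧ ∀ σ ∈ closedBall (0 : ℂ × ℂ) 1, ‖P σ‖ ≤ C * ‖σ‖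
  deriv_inj : Function.Injective (fderiv ℂ P 0)
  range_deriv : (fderiv ℂ P 0).range = Eu
  solution : ∀ σ ∈ ball (0 : ℂ × ℂ) 1, ∀ t ≤ 0,
    HasDerivWithinAt (fun t => P (linFlow l t σ)) (A (P (linFlow l t σ)) + N (P (linFlow l t σ)))
      (Iic 0) t

/-- A backward invariant open neighbourhood of the origin in the unit polydisk. -/
structure IsUnstableDomain (l : ℂ × ℂ) (B : Set (ℂ × ℂ)) : Prop where
  isOpen : IsOpen B
  zero_mem : 0 ∈ B
  subset : B ⊆ ball 0 1
  invariant : ∀ σ ∈ B, ∀ t ≤ 0, linFlow l t σ ∈ B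

/-- `N` is quadratic, so Lipschitz bounds hold only on balls; this suffices for Grönwall because the
orbits being compared are bounded. -/
lemma exists_lipschitzOnWith {A : E →L[ℂ] E} {N : E → E}
    (hN : ∃ κ, 0 ≤ κ ∧ ∀ x y, ‖N x - N y‖ ≤ κ * (‖x‖ + ‖y‖) * ‖x - y‖) {r : ℝ} (hr : 0 ≤ r) :
    ∃ K, LipschitzOnWith K (fun x => A x + N x) (closedBall 0 r) := by
  obtain ⟨κ, hκ, h⟩ := hN
  refine ⟨Real.toNNReal (‖A‖ + κ * (r + r)), LipschitzOnWith.of_dist_le_mul ?_⟩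
  intro x hx y hy
  rw [mem_closedBall_zero_iff] at hx hy
  rw [Real.coe_toNNReal _ (by positivity), dist_eq_norm, dist_eq_norm, add_mul]
  calc ‖A x + N x - (A y + N y)‖ = ‖A (x - y) + (N x - N y)‖ := by rw [map_sub]; congr 1; abel
    _ ≤ ‖A (x - y)‖ + ‖N x - N y‖ := norm_add_le _ _
    _ ≤ ‖A‖ * ‖x - y‖ + κ * (‖x‖ + ‖y‖) * ‖x - y‖ := add_le_add (A.le_opNorm _) (h x y)
    _ ≤ _ := by gcongr

namespace IsUnstableParam

variable {A : E →L[ℂ] E} {N : E → E} {l : ℂ × ℂ} {s : Multiset ℂ}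
    {Eu : Submodule ℂ E} {P : ℂ × ℂ → E} (h : IsUnstableParam A N l s Eu P)

include h

lemma apply_zero : P 0 = 0 := by
  obtain ⟨C, -, hC⟩ := h.bound
  simpa using hC 0 (by simp)

lemma linFlow_norm_le {t : ℝ} (ht : t ≤ 0) (σ : ℂ × ℂ) :
    ‖linFlow l t σ‖ ≤ Real.exp (min l.1.re l.2.re * t) * ‖σ‖ :=
  norm_linFlow_le (min_le_left _ _) (min_le_right _ _) ht σ

lemma min_re_pos : 0 < min l.1.re l.2.re := lt_min h.re_fst_pos h.re_snd_pos

lemma linFlow_norm_le_self {t : ℝ} (ht : t ≤ 0) (σ : ℂ × ℂ) : ‖linFlow l t σ‖ ≤ ‖σ‖ := by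
  refine (h.linFlow_norm_le ht σ).trans (mul_le_of_le_one_left (norm_nonneg _) ?_)
  rw [Real.exp_le_one_iff]
  exact mul_nonpos_of_nonneg_of_nonpos h.min_re_pos.le ht

/-- The orbits on the image of `P` decay exponentially. -/
lemma exists_decay : ∃ C, 0 ≤ C ∧ ∀ σ ∈ closedBall (0 : ℂ × ℂ) 1, ∀ t ≤ 0,
    ‖P (linFlow l t σ)‖ ≤ C * ‖σ‖ * Real.exp (min l.1.re l.2.re * t) := by
  obtain ⟨C, hC, hb⟩ := h.bound
  refine ⟨C, hC, fun σ hσ t ht => (hb _ ?_).trans ?_⟩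
  · rw [mem_closedBall_zero_iff] at hσ ⊢
    exact (h.linFlow_norm_le_self ht σ).trans hσ
  · rw [mul_assoc, mul_comm ‖σ‖]
    gcongr
    exact h.linFlow_norm_le ht σ

/-- All backward orbits on the image of the polydisk lie in a ball. -/
lemma exists_bounded : ∃ R, 0 ≤ R ∧ ∀ σ ∈ ball (0 : ℂ × ℂ) 1, ∀ t ≤ 0,
    P (linFlow l t σ) ∈ closedBall 0 R := by
  obtain ⟨C, hC, hb⟩ := h.bound
  refine ⟨C, hC, fun σ hσ t ht => ?_⟩
  rw [mem_ball_zero_iff] at hσ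
  have h1 := (h.linFlow_norm_le_self ht σ).trans hσ.le
  rw [mem_closedBall_zero_iff]
  exact (hb _ (by simpa using h1)).trans (mul_le_of_le_one_right hC h1)

/-- The contraction factor `e^{-mT}` does not depend on `σ`, so one time `T` serves the whole
polydisk. -/
lemma exists_linFlow_small {δ : ℝ} (hδ : 0 < δ) :
    ∃ T ≥ 0, ∀ σ ∈ ball (0 : ℂ × ℂ) 1, linFlow l (-T) σ ∈ ball 0 δ := by
  have hm := h.min_re_pos
  have h1 : Filter.Tendsto (fun t : ℝ => Real.exp (min l.1.re l.2.re * t)) Filter.atBot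
      (nhds 0) := Real.tendsto_exp_atBot.comp (Filter.tendsto_id.const_mul_atBot hm)
  obtain ⟨t, ht, ht0⟩ := ((h1.eventually_lt_const hδ).and (Filter.eventually_le_atBot 0)).exists
  refine ⟨-t, by linarith, fun σ hσ => ?_⟩
  rw [mem_ball_zero_iff] at hσ ⊢
  rw [neg_neg]
  refine (h.linFlow_norm_le ht0 σ).trans_lt ?_
  nlinarith [Real.exp_pos (min l.1.re l.2.re * t), norm_nonneg σ]

/-! ### Injectivity and immersivity of the parametrization. -/

lemma hasStrictFDerivAt_zero : HasStrictFDerivAt P (fderiv ℂ P 0) 0 :=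
  (h.analytic 0 (by simp)).hasStrictFDerivAt

/-- The injective derivative at `0` expands at least by `K⁻¹`; strict differentiability keeps the
error below half of that. -/
lemma exists_antilipschitz_nhds : ∃ δ > 0, ∃ c > 0, ∀ σ ∈ ball (0 : ℂ × ℂ) δ,
    ∀ τ ∈ ball (0 : ℂ × ℂ) δ, c * ‖σ - τ‖ ≤ ‖P σ - P τ‖ := by
  obtain ⟨K, hK, hanti⟩ := (fderiv ℂ P 0).toLinearMap.exists_antilipschitzWith
    (LinearMap.ker_eq_bot.2 h.deriv_inj)
  have hK' : (0 : ℝ) < K := hK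
  have hsmall := h.hasStrictFDerivAt_zero.isLittleO.def (c := (K : ℝ)⁻¹ / 2) (by positivity)
  rw [Metric.eventually_nhds_iff_ball] at hsmall
  obtain ⟨δ, hδ, hb⟩ := hsmall
  refine ⟨δ, hδ, (K : ℝ)⁻¹ / 2, by positivity, fun σ hσ τ hτ => ?_⟩
  have h1 := hb (σ, τ) (by
    rw [← Prod.mk_zero_zero, ← ball_prod_same]; exact ⟨hσ, hτ⟩)
  have h2 := hanti.le_mul_dist σ τ
  rw [dist_eq_norm, dist_eq_norm, ← map_sub] at h2
  have h3 : (K : ℝ)⁻¹ * ‖σ - τ‖ ≤ ‖fderiv ℂ P 0 (σ - τ)‖ := by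
    rw [inv_mul_le_iff₀ hK']; exact h2
  have h4 := norm_sub_norm_le (fderiv ℂ P 0 (σ - τ)) (P σ - P τ)
  rw [norm_sub_rev (fderiv ℂ P 0 (σ - τ))] at h4
  simp only at h1
  linarith

/-- `P` is antilipschitz on the closed polydisk. -/
lemma exists_antilipschitz : ∃ c > 0, ∀ σ ∈ closedBall (0 : ℂ × ℂ) 1,
    ∀ τ ∈ closedBall (0 : ℂ × ℂ) 1, c * ‖σ - τ‖ ≤ ‖P σ - P τ‖ := by
  obtain ⟨δ, hδ, c, hc, hloc⟩ := h.exists_antilipschitz_nhds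
  obtain ⟨T, hT, hTb⟩ := h.exists_linFlow_small hδ
  obtain ⟨R, hR, hRb⟩ := h.exists_bounded
  obtain ⟨K, hK⟩ := exists_lipschitzOnWith (A := A) h.nonlin hR
  set M := ‖linFlow l T‖ + 1
  have hM : 0 < M := by positivity
  -- Flow both points back by `T` and use the local estimate. Returning costs a factor `M` in the
  -- parameter plane and `e^{KT}` along the orbits.
  have hopen : ∀ σ ∈ ball (0 : ℂ × ℂ) 1, ∀ τ ∈ ball (0 : ℂ × ℂ) 1,
      c / (M * Real.exp (K * T)) * ‖σ - τ‖ ≤ ‖P σ - P τ‖ := by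
    intro σ hσ τ hτ
    have h1 := norm_sub_le_of_solutions hK
      (fun t ht => ⟨hRb σ hσ t ht, h.solution σ hσ t ht⟩)
      (fun t ht => ⟨hRb τ hτ t ht, h.solution τ hτ t ht⟩) le_rfl (t := -T) (by linarith)
    simp only [linFlow_zero, sub_zero, abs_neg, abs_of_nonneg hT] at h1
    have h2 := hloc _ (hTb σ hσ) _ (hTb τ hτ)
    have h3 : ‖σ - τ‖ ≤ M * ‖linFlow l (-T) σ - linFlow l (-T) τ‖ := by
      have : σ - τ = linFlow l T (linFlow l (-T) σ - linFlow l (-T) τ) := by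
        rw [map_sub, linFlow_linFlow, linFlow_linFlow]; simp
      rw [this]
      refine (ContinuousLinearMap.le_opNorm _ _).trans ?_
      gcongr
      simp [M]
    rw [div_mul_eq_mul_div, div_le_iff₀ (by positivity)]
    calc c * ‖σ - τ‖ ≤ c * (M * ‖linFlow l (-T) σ - linFlow l (-T) τ‖) := by gcongr
      _ = M * (c * ‖linFlow l (-T) σ - linFlow l (-T) τ‖) := by ring
      _ ≤ M * (‖P σ - P τ‖ * Real.exp (K * T)) := by exact mul_le_mul_of_nonneg_left (h2.trans h1) hM.le
      _ = _ := by ring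
  refine ⟨c / (M * Real.exp (K * T)), by positivity, fun σ hσ τ hτ => ?_⟩
  -- Boundary points are radial limits `r σ`, `r → 1`, of interior ones, and the inequality is
  -- closed.
  have hlim : ∀ σ ∈ closedBall (0 : ℂ × ℂ) 1, Filter.Tendsto (fun r : ℝ => (r : ℂ) • σ)
      (nhdsWithin 1 (Ico 0 1)) (nhds σ) ∧ Filter.Tendsto (fun r : ℝ => P ((r : ℂ) • σ))
      (nhdsWithin 1 (Ico 0 1)) (nhds (P σ)) := by
    intro σ hσ
    have h1 : Filter.Tendsto (fun r : ℝ => (r : ℂ) • σ) (nhdsWithin 1 (Ico 0 1)) (nhds σ) := by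
      have : Continuous fun r : ℝ => (r : ℂ) • σ := by fun_prop
      have h2 := this.tendsto 1
      simp only [Complex.ofReal_one, one_smul] at h2
      exact h2.mono_left nhdsWithin_le_nhds
    refine ⟨h1, (h.continuousOn σ hσ).tendsto.comp
      (tendsto_nhdsWithin_iff.2 ⟨h1, ?_⟩)⟩
    filter_upwards [self_mem_nhdsWithin] with r hr
    rw [mem_closedBall_zero_iff] at hσ ⊢
    rw [norm_smul, Complex.norm_real, Real.norm_of_nonneg hr.1]
    nlinarith [hr.1, hr.2, norm_nonneg σ]
  have hne : (nhdsWithin (1 : ℝ) (Ico 0 1)).NeBot := by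
    rw [← mem_closure_iff_nhdsWithin_neBot, closure_Ico (by norm_num)]
    simp
  refine le_of_tendsto_of_tendsto
    (((hlim σ hσ).1.sub (hlim τ hτ).1).norm.const_mul (c / (M * Real.exp (K * T))))
    (((hlim σ hσ).2.sub (hlim τ hτ).2).norm) ?_
  filter_upwards [self_mem_nhdsWithin] with r hr
  have hin : ∀ σ ∈ closedBall (0 : ℂ × ℂ) 1, (r : ℂ) • σ ∈ ball (0 : ℂ × ℂ) 1 := by
    intro σ hσ
    rw [mem_closedBall_zero_iff] at hσ
    rw [mem_ball_zero_iff, norm_smul, Complex.norm_real, Real.norm_of_nonneg hr.1]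
    nlinarith [hr.1, hr.2, norm_nonneg σ]
  exact hopen _ (hin σ hσ) _ (hin τ hτ)

/-- Injectivity up to the boundary is what separates `P '' B` from `P '' frontier B`. -/
lemma injOn : InjOn P (closedBall 0 1) := by
  obtain ⟨c, hc, hanti⟩ := h.exists_antilipschitz
  intro σ hσ τ hτ heq
  have := hanti σ hσ τ hτ
  rw [heq, sub_self, norm_zero] at this
  have h1 : ‖σ - τ‖ ≤ 0 := by
    by_contra hlt
    push Not at hlt
    nlinarith
  exact sub_eq_zero.1 (norm_le_zero_iff.1 h1)

/-- If the derivative killed `v ≠ 0`, the difference quotients along `v` would tend to `0`, against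
the lower bound `c ‖v‖`. -/
lemma fderiv_injective {σ : ℂ × ℂ} (hσ : σ ∈ ball 0 1) :
    Function.Injective (fderiv ℂ P σ) := by
  obtain ⟨c, hc, hanti⟩ := h.exists_antilipschitz
  rw [injective_iff_map_eq_zero]
  intro v hv
  have hd : HasFDerivAt P (fderiv ℂ P σ) σ := (h.analytic σ hσ).differentiableAt.hasFDerivAt
  have h1 : HasDerivAt (fun z : ℂ => σ + z • v) v 0 := by
    simpa using ((hasDerivAt_id (0 : ℂ)).smul_const v).const_add σ
  have h2 : HasDerivAt (fun z : ℂ => P (σ + z • v)) 0 0 := by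
    have := HasFDerivAt.comp_hasDerivAt (𝕜 := ℂ) (l := P) (l' := fderiv ℂ P σ) (0 : ℂ)
      (by simpa using hd) h1
    rwa [hv] at this
  by_contra hv0
  have hv1 : 0 < ‖v‖ := norm_pos_iff.2 hv0
  have h3 := h2.isLittleO.def (c := c * ‖v‖ / 2) (by positivity)
  have h4 : ∀ᶠ z : ℂ in nhds 0, σ + z • v ∈ ball (0 : ℂ × ℂ) 1 := by
    have : Filter.Tendsto (fun z : ℂ => σ + z • v) (nhds 0) (nhds σ) := by
      simpa using h1.continuousAt.tendsto
    exact this.eventually (isOpen_ball.mem_nhds hσ)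
  obtain ⟨z, ⟨hz3, hz4⟩, hz⟩ := (((h3.and h4).filter_mono nhdsWithin_le_nhds).and
    (self_mem_nhdsWithin : {(0 : ℂ)}ᶜ ∈ nhdsWithin 0 {(0 : ℂ)}ᶜ)).exists
  have h6 := hanti _ (ball_subset_closedBall hz4) _ (ball_subset_closedBall hσ)
  have hz0 : 0 < ‖z‖ := norm_pos_iff.2 hz
  simp only [zero_smul, add_zero, sub_zero, smul_zero, add_sub_cancel_left, norm_smul] at h6 hz3
  have : 0 < c * ‖v‖ * ‖z‖ := by positivity
  linarith

/-- Biholomorphic parametrization of the image of an open subset of the polydisk. -/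
lemma isAnalyticParametrization {B : Set (ℂ × ℂ)} (hBo : IsOpen B) (hB : B ⊆ ball 0 1) :
    IsAnalyticParametrization ℂ P B (P '' B) where
  isOpen := hBo
  analytic := h.analytic.mono hB
  immersion v hv := h.fderiv_injective (hB hv)
  embedding := by
    obtain ⟨c, hc, hanti⟩ := h.exists_antilipschitz
    have h1 : AntilipschitzWith (Real.toNNReal c⁻¹) (B.domRestrict P) := by
      refine AntilipschitzWith.of_le_mul_dist fun x y => ?_
      rw [Real.coe_toNNReal _ (by positivity), Subtype.dist_eq, dist_eq_norm, dist_eq_norm]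
      rw [← div_eq_inv_mul, le_div_iff₀' hc]
      exact hanti x (ball_subset_closedBall (hB x.2)) y (ball_subset_closedBall (hB y.2))
    exact h1.isEmbedding (continuousOn_iff_continuous_domRestrict.1
      (h.analytic.continuousOn.mono hB))
  image_eq := rfl

/-! ### The image as an unstable set. -/

/-- `q(A) P` as a map into the unstable subspace, where `q` has the roots `s`. -/
lemma exists_chart [FiniteDimensional ℂ E] :
    ∃ (G : ℂ × ℂ → Eu) (e : (ℂ × ℂ) ≃L[ℂ] Eu), AnalyticOnNhd ℂ G (ball 0 1) ∧
      HasStrictFDerivAt G (e : (ℂ × ℂ) →L[ℂ] Eu) 0 ∧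
      ∀ σ, (G σ : E) = aeval A (s.map (fun ν => X - C ν)).prod (P σ) := by
  set Q : E →L[ℂ] E := aeval A (s.map (fun ν => X - C ν)).prod with hQ
  set Q' : E →L[ℂ] Eu := Q.codRestrict Eu h.aeval_mem with hQ'
  set D : (ℂ × ℂ) →L[ℂ] Eu := Q'.comp (fderiv ℂ P 0) with hD
  have hmem : ∀ v, fderiv ℂ P 0 v ∈ Eu := fun v => by
    rw [← h.range_deriv]; exact ⟨v, rfl⟩
  have hinj : Function.Injective D := by
    rw [injective_iff_map_eq_zero]
    intro v hv
    have h1 : Q (fderiv ℂ P 0 v) = 0 := congrArg (Subtype.val) hv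
    have h2 := h.aeval_inj _ (hmem v) h1
    exact (injective_iff_map_eq_zero _).1 h.deriv_inj v h2
  -- `P'(0)` is itself an isomorphism of `ℂ²` onto `Eu`, so injectivity of `D` suffices.
  have hdim : Module.finrank ℂ (ℂ × ℂ) = Module.finrank ℂ Eu := by
    rw [← h.range_deriv]
    exact (LinearMap.finrank_range_of_inj h.deriv_inj).symm
  set e : (ℂ × ℂ) ≃L[ℂ] Eu :=
    (LinearEquiv.ofInjectiveOfFinrankEq D.toLinearMap hinj hdim).toContinuousLinearEquiv with he
  have heD : (e : (ℂ × ℂ) →L[ℂ] Eu) = D := by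
    ext <;> rfl
  refine ⟨fun σ => Q' (P σ), e, ?_, ?_, fun σ => rfl⟩
  · exact fun σ hσ => (Q'.analyticAt _).comp (h.analytic σ hσ)
  · rw [heD]
    exact Q'.hasStrictFDerivAt.comp 0 h.hasStrictFDerivAt_zero

/-- Decaying orbits with the same unstable component coincide, if they are small enough. -/
lemma exists_unique_of_small {μ : ℝ} (hμ : 0 < μ) (h₁ : μ < l.1.re) (h₂ : μ < l.2.re) :
    ∃ r > 0, ∀ (γ₁ γ₂ : ℝ → E) (C₁ C₂ : ℝ),
      (∀ t ≤ 0, ‖γ₁ t‖ ≤ r) → (∀ t ≤ 0, ‖γ₂ t‖ ≤ r) →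
      (∀ t ≤ 0, HasDerivWithinAt γ₁ (A (γ₁ t) + N (γ₁ t)) (Iic 0) t) →
      (∀ t ≤ 0, HasDerivWithinAt γ₂ (A (γ₂ t) + N (γ₂ t)) (Iic 0) t) →
      (∀ t ≤ 0, ‖γ₁ t‖ ≤ C₁ * Real.exp (μ * t)) →
      (∀ t ≤ 0, ‖γ₂ t‖ ≤ C₂ * Real.exp (μ * t)) →
      aeval A (s.map (fun ν => X - C ν)).prod (γ₁ 0) =
        aeval A (s.map (fun ν => X - C ν)).prod (γ₂ 0) →
      ∀ t ≤ 0, γ₁ t = γ₂ t := by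
  obtain ⟨ε, hε, H⟩ := exists_lipschitz_imp_unique A hμ s h.re_nonpos h₁ h₂ h.aeval_eq_zero
  obtain ⟨κ, hκ, hN⟩ := h.nonlin
  -- On the ball of this radius `r` the quadratic `N` has Lipschitz constant at most `κ (r + r) ≤
  -- ε`.
  refine ⟨ε / (2 * (κ + 1)), by positivity, ?_⟩
  intro γ₁ γ₂ C₁ C₂ hr₁ hr₂
  refine H N γ₁ γ₂ C₁ C₂ fun t ht => (hN _ _).trans ?_
  gcongr
  calc κ * (‖γ₁ t‖ + ‖γ₂ t‖) ≤ (κ + 1) * (ε / (2 * (κ + 1)) + ε / (2 * (κ + 1))) := by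
        gcongr
        · linarith
        · exact hr₁ t ht
        · exact hr₂ t ht
    _ = ε := by field_simp; ring

/-- Solutions through the same point of the image of `P` coincide in backward time. -/
lemma eq_of_eq {γ : ℝ → E} {R : ℝ} (hγb : ∀ t ≤ 0, ‖γ t‖ ≤ R)
    (hγ : ∀ t ≤ 0, HasDerivWithinAt γ (A (γ t) + N (γ t)) (Iic 0) t) {σ : ℂ × ℂ}
    (hσ : σ ∈ ball 0 1) {r t : ℝ} (hr : r ≤ 0) (ht : t ≤ 0)
    (heq : γ r = P (linFlow l r σ)) : γ t = P (linFlow l t σ) := by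
  obtain ⟨R', hR', hb⟩ := h.exists_bounded
  obtain ⟨K, hK⟩ := exists_lipschitzOnWith (A := A) h.nonlin
    (r := max R R') (hR'.trans (le_max_right _ _))
  have := norm_sub_le_of_solutions hK (γ₁ := γ) (γ₂ := fun t => P (linFlow l t σ))
    (fun t ht => ⟨by
      rw [mem_closedBall_zero_iff]; exact (hγb t ht).trans (le_max_left _ _), hγ t ht⟩)
    (fun t ht => ⟨closedBall_subset_closedBall (le_max_right _ _) (hb σ hσ t ht),
      h.solution σ hσ t ht⟩) hr ht
  rw [heq, sub_self, norm_zero, zero_mul] at this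
  exact sub_eq_zero.1 (norm_le_zero_iff.1 this)

/-- Every exponentially decaying orbit enters the image of `P`. -/
lemma exists_mem_of_decay [FiniteDimensional ℂ E] {B : Set (ℂ × ℂ)} (hB : IsUnstableDomain l B)
    {γ : ℝ → E} (hγ : ∀ t ≤ 0, HasDerivWithinAt γ (A (γ t) + N (γ t)) (Iic 0) t) {C' μ : ℝ}
    (hμ : 0 < μ) (hC : ∀ t ≤ 0, ‖γ t‖ ≤ C' * Real.exp (μ * t)) :
    ∃ a ≤ 0, ∃ σ ∈ B, γ a = P σ := by
  have hC0 : 0 ≤ C' := by simpa using (norm_nonneg _).trans (hC 0 le_rfl)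
  have hm := h.min_re_pos
  set m := min l.1.re l.2.re with hm_def
  -- A common rate for the given orbit and the orbits on the image, strictly below both unstable
  -- exponents as uniqueness requires.
  set μ' := min μ (m / 2) with hμ'_def
  have hμ' : 0 < μ' := lt_min hμ (by linarith)
  have hμm : μ' < m := (min_le_right _ _).trans_lt (by linarith)
  have hC' : ∀ t ≤ 0, ‖γ t‖ ≤ C' * Real.exp (μ' * t) := fun t ht => (hC t ht).trans (by
    gcongr ?_ * ?_
    exact Real.exp_le_exp.2 (mul_le_mul_of_nonpos_right (min_le_left _ _) ht))
  obtain ⟨r, hr, huniq⟩ := h.exists_unique_of_small hμ' (hμm.trans_le (min_le_left _ _))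
    (hμm.trans_le (min_le_right _ _))
  obtain ⟨G, e, hGa, hGd, hG⟩ := h.exists_chart
  obtain ⟨C₀, hC₀, hdecay⟩ := h.exists_decay
  have htend : Filter.Tendsto γ Filter.atBot (nhds 0) := by
    have h1 : Filter.Tendsto (fun t : ℝ => C' * Real.exp (μ' * t)) Filter.atBot
        (nhds (C' * 0)) := (Real.tendsto_exp_atBot.comp
          (Filter.tendsto_id.const_mul_atBot hμ')).const_mul C'
    rw [mul_zero] at h1
    exact squeeze_zero_norm' ((Filter.eventually_le_atBot 0).mono hC') h1
  set Q : E →L[ℂ] E := aeval A (s.map (fun ν => X - C ν)).prod with hQ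
  -- The radius ensures `C₀ ‖σ‖ ≤ r`, so the entire backward orbit of `P σ` stays where uniqueness
  -- holds; `G '' V` is still a neighbourhood of `0`.
  set V : Set (ℂ × ℂ) := B ∩ ball 0 (min 1 (r / (C₀ + 1))) with hV
  have hVn : V ∈ nhds (0 : ℂ × ℂ) := Filter.inter_mem (hB.isOpen.mem_nhds hB.zero_mem)
    (ball_mem_nhds _ (by positivity))
  have hGV : G '' V ∈ nhds (0 : Eu) := by
    have h1 := hGd.map_nhds_eq_of_equiv
    have h2 : G 0 = 0 := by
      apply Subtype.ext; rw [hG, h.apply_zero, map_zero]; rfl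
    rw [h2] at h1
    rw [← h1]
    exact Filter.image_mem_map hVn
  have hQt : Filter.Tendsto (fun t => (⟨Q (γ t), h.aeval_mem _⟩ : Eu)) Filter.atBot (nhds 0) := by
    rw [tendsto_subtype_rng]
    have := (Q.continuous.tendsto 0).comp htend
    rwa [map_zero] at this
  have hsmall : ∀ᶠ t in Filter.atBot, ‖γ t‖ ≤ r := by
    have := htend.eventually (ball_mem_nhds (0 : E) hr)
    exact this.mono fun t ht => (mem_ball_zero_iff.1 ht).le
  rw [Filter.eventually_atBot] at hsmall
  obtain ⟨b, hb⟩ := hsmall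
  obtain ⟨a, ⟨hab, ha0⟩, σ, ⟨hσB, hσ⟩, hGσ⟩ := (((Filter.eventually_le_atBot b).and
    (Filter.eventually_le_atBot 0)).and (hQt.eventually hGV)).exists
  refine ⟨a, ha0, σ, hσB, ?_⟩
  rw [mem_ball_zero_iff] at hσ
  have hσ1 : ‖σ‖ < 1 := hσ.trans_le (min_le_left _ _)
  have hσ2 : C₀ * ‖σ‖ ≤ r := by
    have h1 := hσ.le.trans (min_le_right _ _)
    rw [le_div_iff₀ (by positivity)] at h1
    nlinarith [norm_nonneg σ]
  have key := huniq (fun t => γ (t + a)) (fun t => P (linFlow l t σ)) C' (C₀ * ‖σ‖)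
    (fun t ht => hb _ (by linarith)) (fun t ht => by
      refine (hdecay σ (by simpa using hσ1.le) t ht).trans ?_
      refine (mul_le_of_le_one_right (by positivity) ?_).trans hσ2
      rw [Real.exp_le_one_iff]
      exact mul_nonpos_of_nonneg_of_nonpos hm.le ht)
    (hasDerivWithinAt_shift (F := fun x => A x + N x) hγ ha0)
    (h.solution σ (by simpa using hσ1))
    (fun t ht => (hC' _ (by linarith)).trans (by
      gcongr ?_ * ?_
      exact Real.exp_le_exp.2 (by nlinarith)))
    (fun t ht => (hdecay σ (by simpa using hσ1.le) t ht).trans (by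
      gcongr ?_ * ?_
      exact Real.exp_le_exp.2 (mul_le_mul_of_nonpos_right hμm.le ht)))
    (by
      have := congrArg Subtype.val hGσ
      rw [hG] at this
      simpa using this.symm) 0 le_rfl
  simpa using key

/-- The image of `P` is the unstable set relative to the complement of the image of the
boundary. -/
lemma image_eq_localUnstableSet [FiniteDimensional ℂ E] {B : Set (ℂ × ℂ)}
    (hB : IsUnstableDomain l B) :
    IsOpen (P '' frontier B)ᶜ ∧ 0 ∈ (P '' frontier B)ᶜ ∧
      P '' B = localUnstableSet (fun x => A x + N x) (P '' frontier B)ᶜ := by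
  have hcl : closure B ⊆ closedBall 0 1 :=
    (closure_mono hB.subset).trans closure_ball_subset_closedBall
  have hfr : frontier B ⊆ closedBall 0 1 := frontier_subset_closure.trans hcl
  -- An open set is disjoint from its frontier, and `P` is injective on the closed polydisk.
  have hBfr : ∀ σ ∈ B, P σ ∈ (P '' frontier B)ᶜ := by
    rintro σ hσ ⟨τ, hτ, heq⟩
    have := h.injOn (hfr hτ) (hcl (subset_closure hσ)) heq
    rw [this, hB.isOpen.frontier_eq] at hτ
    exact hτ.2 hσ
  refine ⟨?_, ?_, ?_⟩
  · have : IsCompact (frontier B) :=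
      (isCompact_closedBall (0 : ℂ × ℂ) 1).of_isClosed_subset isClosed_frontier hfr
    exact (this.image_of_continuousOn (h.continuousOn.mono hfr)).isClosed.isOpen_compl
  · rw [← h.apply_zero]
    exact hBfr 0 hB.zero_mem
  · apply Subset.antisymm
    · rintro _ ⟨σ, hσ, rfl⟩
      obtain ⟨C₀, hC₀, hdecay⟩ := h.exists_decay
      exact ⟨fun t => P (linFlow l t σ), by simp, fun t ht =>
        ⟨hBfr _ (hB.invariant σ hσ t ht), h.solution σ (hB.subset hσ) t ht⟩,
        C₀ * ‖σ‖, _, h.min_re_pos, hdecay σ (ball_subset_closedBall (hB.subset hσ))⟩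
    · rintro x ⟨γ, rfl, hγ, C', μ, hμ, hC⟩
      obtain ⟨a, ha, σ, hσ, haσ⟩ := h.exists_mem_of_decay hB (fun t ht => (hγ t ht).2) hμ hC
      have hC0 : 0 ≤ C' := by simpa using (norm_nonneg _).trans (hC 0 le_rfl)
      have hγb : ∀ t ≤ 0, ‖γ t‖ ≤ C' := fun t ht => (hC t ht).trans
        (mul_le_of_le_one_right hC0 (by rw [Real.exp_le_one_iff]; nlinarith))
      -- The orbit through `P (linFlow l (t - a) σ)` meets `γ` at time `a`; uniqueness, valid in
      -- both time directions, makes them agree at time `t`.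
      have hfollow : ∀ t ∈ Icc a 0, linFlow l (t - a) σ ∈ B → γ t = P (linFlow l (t - a) σ) := by
        intro t ht hmem
        have := h.eq_of_eq (γ := fun u => γ (u + t)) (R := C')
          (fun u hu => hγb _ (by linarith [ht.2]))
          (hasDerivWithinAt_shift (F := fun x => A x + N x) (fun t ht => (hγ t ht).2) ht.2)
          (hB.subset hmem) (r := a - t) (t := 0) (by linarith [ht.1]) le_rfl (by
            rw [linFlow_linFlow]; simpa using haσ)
        simpa using this
      have hall : ∀ t ∈ Icc a 0, linFlow l (t - a) σ ∈ B := by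
        by_contra hcon
        push Not at hcon
        -- If the parameter leaves `B`, there is a first exit time `b`. By continuity `γ b` lies in
        -- `P '' frontier B`, which is forbidden.
        set S : Set ℝ := Icc a 0 ∩ (fun t => linFlow l (t - a) σ) ⁻¹' Bᶜ with hS
        have hcont : Continuous fun t => linFlow l (t - a) σ :=
          (continuous_linFlow l σ).comp (continuous_id.sub continuous_const)
        have hSc : IsCompact S := isCompact_Icc.inter_right
          (hB.isOpen.isClosed_compl.preimage hcont)
        obtain ⟨b, hbS, hbl⟩ := hSc.exists_isLeast hcon
        have hab : a < b := by
          rcases hbS.1.1.eq_or_lt with heq | hlt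
          · exact absurd (by simpa [← heq] using hσ) hbS.2
          · exact hlt
        have hlt : ∀ t ∈ Ico a b, linFlow l (t - a) σ ∈ B := by
          intro t ht
          by_contra hnot
          exact absurd (hbl ⟨⟨ht.1, ht.2.le.trans hbS.1.2⟩, hnot⟩) (not_le.2 ht.2)
        have hne : (nhdsWithin b (Ico a b)).NeBot := by
          rw [← mem_closure_iff_nhdsWithin_neBot, closure_Ico hab.ne]
          exact ⟨hab.le, le_rfl⟩
        have ht1 : Filter.Tendsto (fun t => linFlow l (t - a) σ) (nhdsWithin b (Ico a b))
            (nhds (linFlow l (b - a) σ)) := (hcont.tendsto b).mono_left nhdsWithin_le_nhds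
        have hbcl : linFlow l (b - a) σ ∈ closure B :=
          mem_closure_of_tendsto ht1 (by filter_upwards [self_mem_nhdsWithin] using hlt)
        have ht2 : Filter.Tendsto (fun t => P (linFlow l (t - a) σ)) (nhdsWithin b (Ico a b))
            (nhds (P (linFlow l (b - a) σ))) :=
          (h.continuousOn _ (hcl hbcl)).tendsto.comp (tendsto_nhdsWithin_iff.2 ⟨ht1, by
            filter_upwards [self_mem_nhdsWithin] with t ht
            exact ball_subset_closedBall (hB.subset (hlt t ht))⟩)
        have ht3 : Filter.Tendsto γ (nhdsWithin b (Ico a b)) (nhds (γ b)) :=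
          (hγ b hbS.1.2).2.continuousWithinAt.tendsto.mono_left
            (nhdsWithin_mono _ fun t ht => ht.2.le.trans hbS.1.2)
        have heq : γ b = P (linFlow l (b - a) σ) := by
          refine tendsto_nhds_unique_of_eventuallyEq ht3 ht2 ?_
          filter_upwards [self_mem_nhdsWithin] with t ht
          exact hfollow t ⟨ht.1, ht.2.le.trans hbS.1.2⟩ (hlt t ht)
        refine (hγ b hbS.1.2).1 ⟨_, ?_, heq.symm⟩
        rw [hB.isOpen.frontier_eq]
        exact ⟨hbcl, hbS.2⟩
      have h0 : (0 : ℝ) ∈ Icc a 0 := ⟨ha, le_rfl⟩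
      exact ⟨_, hall 0 h0, (hfollow 0 h0 (hall 0 h0)).symm⟩

/-- The image of `P` is a local unstable manifold. -/
theorem isLocalUnstableManifold [FiniteDimensional ℂ E] {B : Set (ℂ × ℂ)}
    (hB : IsUnstableDomain l B) :
    IsLocalUnstableManifold ℂ (fun x => A x + N x) Eu (P '' B) := by
  obtain ⟨hU, h0U, hMU⟩ := h.image_eq_localUnstableSet hB
  refine ⟨⟨_, hU, h0U, hMU⟩, ?_⟩
  rintro _ ⟨σ, hσ, rfl⟩
  -- Only the linear isomorphism `e` is needed, to identify the model space `Eu` with `ℂ²`; `P ∘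
  -- e.symm` is then a single global chart.
  obtain ⟨G, e, -⟩ := h.exists_chart
  have hpar := h.isAnalyticParametrization hB.isOpen hB.subset
  have hd : ∀ v ∈ e.symm ⁻¹' B, fderiv ℂ (fun v => P (e.symm v)) v =
      (fderiv ℂ P (e.symm v)).comp (e.symm : Eu →L[ℂ] ℂ × ℂ) := fun v hv =>
    (((h.analytic _ (hB.subset hv)).differentiableAt.hasFDerivAt).comp v
      e.symm.hasFDerivAt).fderiv
  refine ⟨univ, e.symm ⁻¹' B, fun v => P (e.symm v), e σ, isOpen_univ, mem_univ _, by simpa,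
    by simp, ?_, ?_⟩
  · refine ⟨hB.isOpen.preimage e.symm.continuous, ?_, ?_, ?_, ?_⟩
    · exact fun v hv => (h.analytic _ (hB.subset hv)).comp ((e.symm : Eu →L[ℂ] ℂ × ℂ).analyticAt v)
    · intro v hv
      rw [hd v hv]
      exact (hpar.immersion _ hv).comp e.symm.injective
    · exact hpar.embedding.comp (e.symm.toHomeomorph.isEmbedding.restrictPreimage B)
    · rw [inter_univ]
      change P ∘ e.symm '' _ = _
      rw [image_comp, image_preimage_eq _ e.symm.surjective]
  · intro hx
    have hσ0 : σ = 0 := h.injOn (ball_subset_closedBall (hB.subset hσ)) (by simp)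
      (hx.trans h.apply_zero.symm)
    rw [hd _ (by simpa using hσ)]
    subst hσ0
    rw [map_zero, map_zero]
    exact (LinearMap.range_comp_of_range_eq_top _
      (LinearMap.range_eq_top.2 e.symm.surjective)).trans h.range_deriv

end IsUnstableParam

end Parametrization

/-! ### The real part of the unstable manifold. -/

section RealParametrization

open Polynomial Set Metric

set_option linter.unusedSectionVars false

variable {E : Type*} [NormedAddCommGroup E] [NormedSpace ℝ E] [NormedSpace ℂ E]
  [IsScalarTower ℝ ℂ E]
  {R : Type*} [NormedAddCommGroup R] [NormedSpace ℝ R]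

/-- A conjugation `κ` of `E` commuting with `x' = A x + N x` and with `Q`, whose fixed points are
the image of the real space `R`, on which the equation reads `y' = f y`. -/
structure IsRealStructure (A : E →L[ℂ] E) (N : E → E) (Q : E →L[ℂ] E) (f : R → R)
    (κ : E →L[ℝ] E) (ι : R →L[ℝ] E) (ρ : E →L[ℝ] R) : Prop where
  norm_conj : ∀ x, ‖κ x‖ = ‖x‖
  conj_field : ∀ x, κ (A x + N x) = A (κ x) + N (κ x)
  conj_comm : ∀ x, κ (Q x) = Q (κ x)
  conj_coe : ∀ y, κ (ι y) = ι y
  coe_re : ∀ x, κ x = x → ι (ρ x) = x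
  re_coe : ∀ y, ρ (ι y) = y
  coe_field : ∀ y, ι (f y) = A (ι y) + N (ι y)

namespace IsUnstableParam

variable {A : E →L[ℂ] E} {N : E → E} {l : ℂ × ℂ} {s : Multiset ℂ}
    {Eu : Submodule ℂ E} {P : ℂ × ℂ → E} (h : IsUnstableParam A N l s Eu P)
    {f : R → R} {κ : E →L[ℝ] E} {ι : R →L[ℝ] E} {ρ : E →L[ℝ] R}
    (hR : IsRealStructure A N (aeval A (s.map (fun ν => X - C ν)).prod) f κ ι ρ)

include h hR

lemma conj_solution {γ : ℝ → E} (hγ : ∀ t ≤ 0, HasDerivWithinAt γ (A (γ t) + N (γ t)) (Iic 0) t) :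
    ∀ t ≤ 0, HasDerivWithinAt (fun t => κ (γ t)) (A (κ (γ t)) + N (κ (γ t))) (Iic 0) t :=
  fun t ht => (κ.hasFDerivAt.comp_hasDerivWithinAt t (hγ t ht)).congr_deriv (hR.conj_field _)

/-- An orbit on the image of `P` that is real at one time is real at all times. -/
lemma conj_eq_of_conj_eq {σ : ℂ × ℂ} (hσ : σ ∈ ball 0 1) {r t : ℝ} (hr : r ≤ 0) (ht : t ≤ 0)
    (heq : κ (P (linFlow l r σ)) = P (linFlow l r σ)) :
    κ (P (linFlow l t σ)) = P (linFlow l t σ) := by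
  obtain ⟨C, hC, hb⟩ := h.exists_bounded
  exact h.eq_of_eq (γ := fun t => κ (P (linFlow l t σ))) (R := C)
    (fun t ht => by rw [hR.norm_conj]; exact mem_closedBall_zero_iff.1 (hb σ hσ t ht))
    (h.conj_solution hR (h.solution σ hσ)) hσ hr ht heq

/-- Close to the origin, the image of `P` is real if its unstable component is. -/
lemma exists_conj_eq_of_small : ∃ δ > 0, δ ≤ 1 ∧ ∀ σ ∈ ball (0 : ℂ × ℂ) δ,
    κ (aeval A (s.map (fun ν => X - C ν)).prod (P σ)) =
      aeval A (s.map (fun ν => X - C ν)).prod (P σ) → κ (P σ) = P σ := by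
  have hm := h.min_re_pos
  obtain ⟨r, hr, huniq⟩ := h.exists_unique_of_small (μ := min l.1.re l.2.re / 2) (by linarith)
    ((half_lt_self hm).trans_le (min_le_left _ _)) ((half_lt_self hm).trans_le (min_le_right _ _))
  obtain ⟨C₀, hC₀, hdecay⟩ := h.exists_decay
  refine ⟨min 1 (r / (C₀ + 1)), by positivity, min_le_left _ _, ?_⟩
  intro σ hσ hκ
  rw [mem_ball_zero_iff] at hσ
  have hσ1 : ‖σ‖ < 1 := hσ.trans_le (min_le_left _ _)
  have hσ2 : C₀ * ‖σ‖ ≤ r := by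
    have h1 := hσ.le.trans (min_le_right _ _)
    rw [le_div_iff₀ (by positivity)] at h1
    nlinarith [norm_nonneg σ]
  have hb := hdecay σ (by simpa using hσ1.le)
  have hb1 : ∀ t ≤ 0, ‖P (linFlow l t σ)‖ ≤ r := fun t ht => by
    refine (hb t ht).trans ((mul_le_of_le_one_right (by positivity) ?_).trans hσ2)
    rw [Real.exp_le_one_iff]
    exact mul_nonpos_of_nonneg_of_nonpos hm.le ht
  have hb2 : ∀ t ≤ 0, ‖P (linFlow l t σ)‖ ≤
      C₀ * ‖σ‖ * Real.exp (min l.1.re l.2.re / 2 * t) := fun t ht => (hb t ht).trans (by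
    gcongr ?_ * ?_
    exact Real.exp_le_exp.2 (by nlinarith))
  have hs := h.solution σ (by simpa using hσ1)
  -- The conjugate orbit is another small decaying solution with the same unstable component at time
  -- `0`.
  have := huniq (fun t => κ (P (linFlow l t σ))) (fun t => P (linFlow l t σ)) _ _
    (fun t ht => (hR.norm_conj _).trans_le (hb1 t ht)) hb1 (h.conj_solution hR hs) hs
    (fun t ht => (hR.norm_conj _).trans_le (hb2 t ht)) hb2 (by
      simp only [linFlow_zero]; rw [← hR.conj_comm, hκ]) 0 le_rfl
  simpa using this

/-- An orbit on the image ending at a real point is real throughout, so `ρ` turns it into a solution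
of the real system; conversely `ι` preserves solutions and decay. -/
lemma preimage_eq_localUnstableSet {U : Set E} {B : Set (ℂ × ℂ)}
    (hB : IsUnstableDomain l B)
    (hBU : P '' B = localUnstableSet (fun x => A x + N x) U) :
    ι ⁻¹' (P '' B) = localUnstableSet f (ι ⁻¹' U) := by
  have hnorm : ∃ K, 0 ≤ K ∧ ∀ x, ‖ρ x‖ ≤ K * ‖x‖ := ⟨‖ρ‖, norm_nonneg _, ρ.le_opNorm⟩
  obtain ⟨K, hK, hKρ⟩ := hnorm
  obtain ⟨C₀, hC₀, hdecay⟩ := h.exists_decay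
  ext y
  constructor
  · rintro ⟨σ, hσ, heq⟩
    have hfix : ∀ t ≤ 0, ι (ρ (P (linFlow l t σ))) = P (linFlow l t σ) := fun t ht =>
      hR.coe_re _ (h.conj_eq_of_conj_eq hR (hB.subset hσ) le_rfl ht (by
        rw [linFlow_zero, heq, hR.conj_coe]))
    refine ⟨fun t => ρ (P (linFlow l t σ)), by simp [heq, hR.re_coe], fun t ht => ⟨?_, ?_⟩,
      K * (C₀ * ‖σ‖), _, h.min_re_pos, ?_⟩
    · rw [mem_preimage, hfix t ht]
      -- A point of the image is the time-`0` value of an orbit inside `U`, hence lies in `U`.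
      have : P (linFlow l t σ) ∈ P '' B := ⟨_, hB.invariant σ hσ t ht, rfl⟩
      rw [hBU] at this
      obtain ⟨γ, h0, hγ, -⟩ := this
      rw [← h0]
      exact (hγ 0 le_rfl).1
    · refine (ρ.hasFDerivAt.comp_hasDerivWithinAt t
        (h.solution σ (hB.subset hσ) t ht)).congr_deriv ?_
      conv_lhs => rw [← hfix t ht]
      rw [← hR.coe_field, hR.re_coe]
    · intro t ht
      refine (hKρ _).trans ?_
      rw [mul_assoc K]
      gcongr
      exact hdecay σ (ball_subset_closedBall (hB.subset hσ)) t ht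
  · rintro ⟨γ, rfl, hγ, C', μ, hμ, hC⟩
    rw [mem_preimage, hBU]
    refine ⟨fun t => ι (γ t), rfl, fun t ht => ⟨(hγ t ht).1, ?_⟩, ‖ι‖ * C', μ, hμ, ?_⟩
    · exact (ι.hasFDerivAt.comp_hasDerivWithinAt t (hγ t ht).2).congr_deriv (hR.coe_field _)
    · intro t ht
      refine (ι.le_opNorm _).trans ?_
      rw [mul_assoc]
      gcongr
      exact hC t ht

/-- A global chart of the real part of the image of `P`. -/
lemma exists_real_chart [FiniteDimensional ℂ E] {B : Set (ℂ × ℂ)} (hB : IsUnstableDomain l B)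
    {EuR : Submodule ℝ R} (hEuR : ∀ y, y ∈ EuR ↔ ι y ∈ Eu) :
    ∃ (V : Set EuR) (φ : EuR → R), IsAnalyticParametrization ℝ φ V (ι ⁻¹' (P '' B)) ∧
      ∀ v ∈ V, φ v = 0 → ∀ w, fderiv ℝ φ v w ∈ EuR := by
  obtain ⟨δ₀, hδ₀, hδ₁, hreal⟩ := h.exists_conj_eq_of_small hR
  obtain ⟨G, e, hGa, hGd, hG⟩ := h.exists_chart
  set Q : E →L[ℂ] E := aeval A (s.map (fun ν => X - C ν)).prod with hQ
  set Γ := hGd.toOpenPartialHomeomorph G with hΓ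
  have hΓG : ∀ σ, Γ σ = G σ := fun σ => rfl
  have hsrc : Γ.source ∈ nhds (0 : ℂ × ℂ) :=
    Γ.open_source.mem_nhds hGd.mem_toOpenPartialHomeomorph_source
  -- Invertibility of the derivative near `0`, and not only at `0`, makes the local inverse analytic
  -- at every point used.
  have hinv : ∀ᶠ σ in nhds (0 : ℂ × ℂ),
      fderiv ℂ G σ ∈ range ((↑) : ((ℂ × ℂ) ≃L[ℂ] Eu) → ((ℂ × ℂ) →L[ℂ] Eu)) := by
    have h1 : ContinuousAt (fderiv ℂ G) 0 := (hGa 0 (by simp)).fderiv.continuousAt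
    refine h1.eventually ?_
    rw [hGd.hasFDerivAt.fderiv]
    exact ContinuousLinearEquiv.nhds e
  obtain ⟨δ, hδ, hδb⟩ := Metric.mem_nhds_iff.1 (Filter.inter_mem (Filter.inter_mem hsrc hinv)
    (ball_mem_nhds _ hδ₀))
  obtain ⟨T, hT, hTb⟩ := h.exists_linFlow_small hδ
  have hball : ball (0 : ℂ × ℂ) δ ⊆ ball 0 1 := fun σ hσ =>
    ball_subset_ball hδ₁ (hδb hσ).2
  -- the coordinates on the real unstable subspace
  set c : EuR →L[ℝ] Eu := (ι.comp EuR.subtypeL).codRestrict (Eu.restrictScalars ℝ)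
    (fun u => (hEuR u).1 u.2) with hc
  have hcv : ∀ u, (c u : E) = ι u := fun u => rfl
  have hc_inj : Function.Injective c := by
    intro u v huv
    have h1 := congrArg (fun x : Eu => ρ x) huv
    simp only [hcv, hR.re_coe] at h1
    exact Subtype.ext h1
  set W : Set (ℂ × ℂ) := ball 0 δ ∩ linFlow l T ⁻¹' B with hW
  have hWo : IsOpen W := isOpen_ball.inter (hB.isOpen.preimage (linFlow l T).continuous)
  -- By the choice of `T`, `W` is exactly `linFlow l (-T) '' B`, so `V` sees all of `B` through the
  -- local inverse of `G`.
  set V : Set EuR := c ⁻¹' (Γ.target ∩ Γ.symm ⁻¹' W) with hV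
  have hVo : IsOpen V := (Γ.isOpen_inter_preimage_symm hWo).preimage c.continuous
  -- The parameter whose backward flow by time `T` has unstable component `u`.
  set θ : EuR → ℂ × ℂ := fun u => linFlow l T (Γ.symm (c u)) with hθ
  have hθB : ∀ u ∈ V, θ u ∈ B := fun u hu => hu.2.2
  have hback : ∀ u, linFlow l (-T) (θ u) = Γ.symm (c u) := fun u => by
    simp [hθ, linFlow_linFlow]
  have hleft : ∀ u ∈ V, G (linFlow l (-T) (θ u)) = c u := fun u hu => by
    rw [hback, ← hΓG, Γ.right_inv hu.1]
  have hfix : ∀ u ∈ V, ι (ρ (P (θ u))) = P (θ u) := by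
    intro u hu
    refine hR.coe_re _ ?_
    have h1 : κ (P (linFlow l (-T) (θ u))) = P (linFlow l (-T) (θ u)) := by
      refine hreal _ ?_ ?_
      · rw [hback]; exact (hδb hu.2.1).2
      · rw [← hG, hleft u hu, hcv, hR.conj_coe]
    have h2 := h.conj_eq_of_conj_eq hR (hB.subset (hθB u hu)) (by linarith) le_rfl h1
    simpa using h2
  have hθa : AnalyticOnNhd ℝ θ V := by
    intro u hu
    have h1 : AnalyticAt ℂ Γ.symm (c u) := by
      obtain ⟨i, hi⟩ := (hδb hu.2.1).1.2
      have := Γ.analyticAt_symm' (i := i) (hδb hu.2.1).1.1 (hGa _ (hball hu.2.1)) hi.symm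
      rwa [Γ.right_inv hu.1] at this
    have h2 : AnalyticAt ℂ (fun x => linFlow l T (Γ.symm x)) (c u) :=
      ((linFlow l T).analyticAt _).comp h1
    exact (h2.restrictScalars (𝕜 := ℝ)).comp (c.analyticAt u)
  have hΨa : AnalyticOnNhd ℝ (fun u => P (θ u)) V := fun u hu =>
    ((h.analytic _ (hB.subset (hθB u hu))).restrictScalars (𝕜 := ℝ)).comp (hθa u hu)
  have hφa : AnalyticOnNhd ℝ (fun u => ρ (P (θ u))) V := fun u hu =>
    (ρ.analyticAt _).comp (hΨa u hu)
  have hder : ∀ u ∈ V, ∀ w, ι (fderiv ℝ (fun u => ρ (P (θ u))) u w) =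
      fderiv ℂ P (θ u) (fderiv ℝ θ u w) := by
    intro u hu w
    have h1 : HasFDerivAt (fun u => ι (ρ (P (θ u))))
        (ι.comp (fderiv ℝ (fun u => ρ (P (θ u))) u)) u :=
      ι.hasFDerivAt.comp u (hφa u hu).differentiableAt.hasFDerivAt
    have h2 : HasFDerivAt (fun u => P (θ u))
        (((fderiv ℂ P (θ u)).restrictScalars ℝ).comp (fderiv ℝ θ u)) u :=
      ((h.analytic _ (hB.subset (hθB u hu))).differentiableAt.hasFDerivAt.restrictScalars ℝ).comp u
        (hθa u hu).differentiableAt.hasFDerivAt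
    have h3 : (fun u => P (θ u)) =ᶠ[nhds u] fun u => ι (ρ (P (θ u))) := by
      filter_upwards [hVo.mem_nhds hu] with v hv using (hfix v hv).symm
    have h4 := (h1.congr_of_eventuallyEq h3).unique h2
    exact congrArg (fun L : EuR →L[ℝ] E => L w) h4
  -- `G ∘ linFlow l (-T)` composed with `θ` is the injective linear map `c`; differentiate this
  -- identity.
  have hθinj : ∀ u ∈ V, Function.Injective (fderiv ℝ θ u) := by
    intro u hu
    have hk : HasFDerivAt (fun σ => G (linFlow l (-T) σ))
        ((fderiv ℂ G (linFlow l (-T) (θ u))).comp (linFlow l (-T))) (θ u) :=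
      (hGa _ (by rw [hback]; exact hball hu.2.1)).differentiableAt.hasFDerivAt.comp _
        (linFlow l (-T)).hasFDerivAt
    have h1 : HasFDerivAt (fun u => G (linFlow l (-T) (θ u))) _ u :=
      (hk.restrictScalars ℝ).comp u (hθa u hu).differentiableAt.hasFDerivAt
    have h3 : (fun u => G (linFlow l (-T) (θ u))) =ᶠ[nhds u] c := by
      filter_upwards [hVo.mem_nhds hu] with v hv using hleft v hv
    have h4 := (c.hasFDerivAt.congr_of_eventuallyEq h3).unique h1
    intro w₁ w₂ hw
    apply hc_inj
    rw [h4]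
    simp only [ContinuousLinearMap.comp_apply, hw]
  have hpar := h.isAnalyticParametrization hB.isOpen hB.subset
  refine ⟨V, fun u => ρ (P (θ u)), ⟨hVo, hφa, ?_, ?_, ?_⟩, ?_⟩
  · intro u hu w₁ w₂ hw
    have h1 := congrArg ι hw
    rw [hder u hu, hder u hu] at h1
    exact hθinj u hu (hpar.immersion _ (hθB u hu) h1)
  · set j : V → B := fun u => ⟨θ u, hθB u u.2⟩ with hj
    have hjc : Continuous j :=
      (continuousOn_iff_continuous_domRestrict.1 hθa.continuousOn).subtype_mk _
    have hGB : ∀ σ : B, linFlow l (-T) σ ∈ ball (0 : ℂ × ℂ) 1 := fun σ => by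
      have := h.linFlow_norm_le_self (t := -T) (by linarith) σ
      have h2 := hB.subset σ.2
      rw [mem_ball_zero_iff] at h2 ⊢
      exact this.trans_lt h2
    have hkc : Continuous fun σ : B => ρ (G (linFlow l (-T) σ) : E) := by
      refine ρ.continuous.comp (continuous_subtype_val.comp ?_)
      exact hGa.continuousOn.comp_continuous
        ((linFlow l (-T)).continuous.comp continuous_subtype_val) hGB
    -- A continuous left inverse, up to the inclusion into `R`, makes `j` an embedding.
    have hje : Topology.IsEmbedding j := by
      refine Topology.IsEmbedding.of_comp hjc hkc ?_
      have : (fun σ : B => ρ (G (linFlow l (-T) σ) : E)) ∘ j = fun u : V => ((u : EuR) : R) := by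
        funext u
        simp only [Function.comp_apply, hj, hleft u u.2, hcv, hR.re_coe]
      rw [this]
      exact Topology.IsEmbedding.subtypeVal.comp Topology.IsEmbedding.subtypeVal
    refine Topology.IsEmbedding.of_comp
      (continuousOn_iff_continuous_domRestrict.1 hφa.continuousOn) ι.continuous ?_
    have : ι ∘ V.domRestrict (fun u => ρ (P (θ u))) = B.domRestrict P ∘ j := by
      funext u
      exact hfix u u.2
    rw [this]
    exact hpar.embedding.comp hje
  · ext y
    constructor
    · rintro ⟨u, hu, rfl⟩
      exact ⟨θ u, hθB u hu, (hfix u hu).symm⟩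
    · rintro ⟨σ, hσ, heq⟩
      have hσδ := hTb σ (hB.subset hσ)
      have h1 : κ (P (linFlow l (-T) σ)) = P (linFlow l (-T) σ) :=
        h.conj_eq_of_conj_eq hR (hB.subset hσ) le_rfl (by linarith) (by
          rw [linFlow_zero, heq, hR.conj_coe])
      -- `P` is real at the pulled-back point and `q(A)` commutes with `κ`, so the coordinate is
      -- real.
      have h2 : ι (ρ (G (linFlow l (-T) σ) : E)) = G (linFlow l (-T) σ) := by
        refine hR.coe_re _ ?_
        rw [hG, hR.conj_comm, h1]
      have hmem : ρ (G (linFlow l (-T) σ) : E) ∈ EuR := by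
        rw [hEuR, h2]; exact (G (linFlow l (-T) σ)).2
      have hcu : c ⟨_, hmem⟩ = Γ (linFlow l (-T) σ) := Subtype.ext h2
      have hsymm : Γ.symm (c ⟨_, hmem⟩) = linFlow l (-T) σ := by
        rw [hcu, Γ.left_inv (hδb hσδ).1.1]
      have hθu : θ ⟨_, hmem⟩ = σ := by
        simp only [hθ, hsymm, linFlow_linFlow]; simp
      refine ⟨⟨_, hmem⟩, ⟨?_, ?_, ?_⟩, ?_⟩
      · rw [hcu]; exact Γ.map_source (hδb hσδ).1.1
      · rw [hsymm]; exact hσδ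
      · change θ ⟨_, hmem⟩ ∈ B
        rw [hθu]; exact hσ
      · simp only [hθu, heq, hR.re_coe]
  · intro v hv hv0 w
    rw [hEuR, hder v hv]
    -- By injectivity `θ v = 0`, so the derivative of the chart factors through `P'(0)`, whose range
    -- is `Eu`.
    have h1 : P (θ v) = P 0 := by
      have hv0' : ρ (P (θ v)) = 0 := hv0
      rw [h.apply_zero, ← hfix v hv, hv0', map_zero]
    rw [h.injOn (ball_subset_closedBall (hB.subset (hθB v hv))) (by simp) h1, ← h.range_deriv]
    exact ⟨_, rfl⟩

/-- The real part of the image of `P` is a local unstable manifold of the real system. -/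
theorem isLocalUnstableManifold_real [FiniteDimensional ℂ E] [FiniteDimensional ℝ R]
    {B : Set (ℂ × ℂ)} (hB : IsUnstableDomain l B)
    {EuR : Submodule ℝ R} (hEuR : ∀ y, y ∈ EuR ↔ ι y ∈ Eu) :
    IsLocalUnstableManifold ℝ f EuR (ι ⁻¹' (P '' B)) := by
  obtain ⟨hU, h0U, hMU⟩ := h.image_eq_localUnstableSet hB
  refine ⟨⟨_, hU.preimage ι.continuous, by simpa using h0U,
    h.preimage_eq_localUnstableSet hR hB hMU⟩, ?_⟩
  obtain ⟨V, φ, hφ, hφ0⟩ := h.exists_real_chart hR hB hEuR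
  intro x hx
  rw [← hφ.image_eq] at hx
  obtain ⟨v, hv, hvx⟩ := hx
  refine ⟨univ, V, φ, v, isOpen_univ, mem_univ _, hv, hvx, by rwa [inter_univ], fun hx0 => ?_⟩
  -- The chart is an immersion modelled on `EuR`, so its tangent space has the right dimension and
  -- one inclusion is enough.
  refine Submodule.eq_of_le_of_finrank_eq ?_
    (LinearMap.finrank_range_of_inj (hφ.immersion v hv))
  rintro _ ⟨w, rfl⟩
  exact hφ0 v hv (hvx.trans hx0) w

end IsUnstableParam

end RealParametrization

/-! ## Absolutely convergent double power series -/

section DoublePowerSeries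

set_option linter.unusedSectionVars false

open Set Metric BoundedContinuousFunction

/-- The bounded sequence with a single entry `1` at `k`. -/
def unitSeq (k : ℕ) : ℕ →ᵇ ℂ :=
  BoundedContinuousFunction.ofNormedAddCommGroup (fun j => if j = k then 1 else 0)
    continuous_of_discreteTopology 1 (fun j => by split_ifs <;> simp)

lemma norm_unitSeq_le (k : ℕ) : ‖unitSeq k‖ ≤ 1 :=
  BoundedContinuousFunction.norm_ofNormedAddCommGroup_le _ zero_le_one _

/-- The sequence of powers of `z`. -/
def powSeq (z : ℂ) : ℕ →ᵇ ℂ := ∑' k : ℕ, z ^ k • unitSeq k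

/-- On smaller disks a geometric series dominates. A double series is a continuous bilinear map
applied to `powSeq σ.1` and `powSeq σ.2`, so its analyticity and termwise derivative reduce to this
one-variable fact. -/
lemma differentiableOn_powSeq : DifferentiableOn ℂ powSeq (ball 0 1) := by
  intro z hz
  rw [mem_ball_zero_iff] at hz
  obtain ⟨r, hzr, hr⟩ := exists_between hz
  have h0 : 0 ≤ r := (norm_nonneg z).trans hzr.le
  have h1 : DifferentiableOn ℂ powSeq (ball 0 r) := by
    refine Complex.differentiableOn_tsum_of_summable_norm (summable_geometric_of_lt_one h0 hr)
      (fun k => ?_) isOpen_ball (fun k w hw => ?_)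
    · exact ((differentiable_id.pow k).smul_const _).differentiableOn
    · rw [mem_ball_zero_iff] at hw
      rw [norm_smul, norm_pow]
      calc ‖w‖ ^ k * ‖unitSeq k‖ ≤ r ^ k * 1 := by
            gcongr; exact norm_unitSeq_le k
        _ = r ^ k := mul_one _
  exact (h1.differentiableAt (isOpen_ball.mem_nhds (by simpa using hzr))).differentiableWithinAt

lemma powSeq_apply {z : ℂ} (hz : z ∈ ball (0 : ℂ) 1) (j : ℕ) : powSeq z j = z ^ j := by
  rw [mem_ball_zero_iff] at hz
  have hs : Summable fun k : ℕ => z ^ k • unitSeq k := by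
    refine Summable.of_norm_bounded (summable_geometric_of_lt_one (norm_nonneg z) hz) fun k => ?_
    rw [norm_smul, norm_pow]
    exact mul_le_of_le_one_right (by positivity) (norm_unitSeq_le k)
  change BoundedContinuousFunction.evalCLM ℂ j (∑' k : ℕ, z ^ k • unitSeq k) = z ^ j
  rw [ContinuousLinearMap.map_tsum _ hs, tsum_eq_single j fun k hk => ?_]
  · simp [unitSeq]
  · simp [unitSeq, hk.symm]

lemma deriv_powSeq_apply {z : ℂ} (hz : z ∈ ball (0 : ℂ) 1) (j : ℕ) :
    deriv powSeq z j = j * z ^ (j - 1) := by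
  have h1 := (differentiableOn_powSeq.differentiableAt (isOpen_ball.mem_nhds hz)).hasDerivAt
  have h2 := (BoundedContinuousFunction.evalCLM ℂ j).hasFDerivAt.comp_hasDerivAt z h1
  have h3 : (fun z : ℂ => z ^ j) =ᶠ[nhds z] (BoundedContinuousFunction.evalCLM ℂ j) ∘ powSeq := by
    filter_upwards [isOpen_ball.mem_nhds hz] with w hw using (powSeq_apply hw j).symm
  exact (h2.congr_of_eventuallyEq h3).unique (hasDerivAt_pow j z)

variable {F : Type*} [NormedAddCommGroup F] [NormedSpace ℂ F] [CompleteSpace F]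

lemma summable_seq_pairing {c : ℕ × ℕ → F} (hc : Summable fun β => ‖c β‖) (a b : ℕ →ᵇ ℂ) :
    Summable fun β : ℕ × ℕ => (a β.1 * b β.2) • c β := by
  refine Summable.of_norm_bounded (hc.mul_left (‖a‖ * ‖b‖)) fun β => ?_
  rw [norm_smul, norm_mul]
  gcongr
  · exact a.norm_coe_le_norm _
  · exact b.norm_coe_le_norm _

/-- The pairing `∑ c_β a_{β₁} b_{β₂}` of a summable double sequence with bounded sequences. -/
def seqPairing (c : ℕ × ℕ → F) (hc : Summable fun β => ‖c β‖) :
    (ℕ →ᵇ ℂ) →L[ℂ] (ℕ →ᵇ ℂ) →L[ℂ] F :=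
  LinearMap.mkContinuous₂
    (LinearMap.mk₂ ℂ (fun a b => ∑' β : ℕ × ℕ, (a β.1 * b β.2) • c β)
      (fun a a' b => by
        rw [← (summable_seq_pairing hc a b).tsum_add (summable_seq_pairing hc a' b)]
        simp [add_mul, add_smul])
      (fun z a b => by
        rw [← (summable_seq_pairing hc a b).tsum_const_smul]
        simp [smul_smul, mul_assoc])
      (fun a b b' => by
        rw [← (summable_seq_pairing hc a b).tsum_add (summable_seq_pairing hc a b')]
        simp [mul_add, add_smul])
      (fun z a b => by
        rw [← (summable_seq_pairing hc a b).tsum_const_smul]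
        simp [smul_smul, mul_left_comm]))
    (∑' β, ‖c β‖) (fun a b => by
      have h1 : HasSum (fun β => ‖a‖ * ‖b‖ * ‖c β‖) (‖a‖ * ‖b‖ * ∑' β, ‖c β‖) :=
        hc.hasSum.mul_left _
      refine (tsum_of_norm_bounded h1 fun β => ?_).trans (le_of_eq (by ring))
      rw [norm_smul, norm_mul]
      gcongr
      · exact a.norm_coe_le_norm _
      · exact b.norm_coe_le_norm _)

lemma hasSum_seqPairing {c : ℕ × ℕ → F} (hc : Summable fun β => ‖c β‖) (a b : ℕ →ᵇ ℂ) :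
    HasSum (fun β : ℕ × ℕ => (a β.1 * b β.2) • c β) (seqPairing c hc a b) :=
  (summable_seq_pairing hc a b).hasSum

/-- The double power series with coefficients `c`. -/
def doubleSeries (c : ℕ × ℕ → F) (σ : ℂ × ℂ) : F :=
  ∑' β : ℕ × ℕ, (σ.1 ^ β.1 * σ.2 ^ β.2) • c β

lemma norm_monomial_le {σ : ℂ × ℂ} (hσ : σ ∈ closedBall (0 : ℂ × ℂ) 1) (β : ℕ × ℕ) :
    ‖σ.1 ^ β.1 * σ.2 ^ β.2‖ ≤ 1 := by
  rw [mem_closedBall_zero_iff] at hσ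
  rw [norm_mul, norm_pow, norm_pow]
  exact mul_le_one₀ (pow_le_one₀ (norm_nonneg _) ((norm_fst_le σ).trans hσ)) (by positivity)
    (pow_le_one₀ (norm_nonneg _) ((norm_snd_le σ).trans hσ))

lemma norm_monomial_le_norm {σ : ℂ × ℂ} (hσ : σ ∈ closedBall (0 : ℂ × ℂ) 1) {β : ℕ × ℕ}
    (hβ : β ≠ 0) : ‖σ.1 ^ β.1 * σ.2 ^ β.2‖ ≤ ‖σ‖ := by
  rw [mem_closedBall_zero_iff] at hσ
  have h1 : ‖σ.1 ^ β.1 * σ.2 ^ β.2‖ ≤ ‖σ‖ ^ (β.1 + β.2) := by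
    rw [norm_mul, norm_pow, norm_pow, pow_add]
    gcongr
    · exact norm_fst_le σ
    · exact norm_snd_le σ
  refine h1.trans (pow_le_of_le_one (norm_nonneg _) hσ ?_)
  intro h0
  exact hβ (Prod.ext (by simp; omega) (by simp; omega))

lemma norm_doubleSeries_term_le (c : ℕ × ℕ → F) {σ : ℂ × ℂ}
    (hσ : σ ∈ closedBall (0 : ℂ × ℂ) 1) (β : ℕ × ℕ) :
    ‖(σ.1 ^ β.1 * σ.2 ^ β.2) • c β‖ ≤ ‖c β‖ := by
  rw [norm_smul]
  exact mul_le_of_le_one_left (norm_nonneg _) (norm_monomial_le hσ β)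

lemma hasSum_doubleSeries {c : ℕ × ℕ → F} (hc : Summable fun β => ‖c β‖) {σ : ℂ × ℂ}
    (hσ : σ ∈ closedBall (0 : ℂ × ℂ) 1) :
    HasSum (fun β : ℕ × ℕ => (σ.1 ^ β.1 * σ.2 ^ β.2) • c β) (doubleSeries c σ) :=
  (Summable.of_norm_bounded hc (norm_doubleSeries_term_le c hσ)).hasSum

lemma continuousOn_doubleSeries {c : ℕ × ℕ → F} (hc : Summable fun β => ‖c β‖) :
    ContinuousOn (doubleSeries c) (closedBall 0 1) :=
  continuousOn_tsum (fun β => by fun_prop) hc fun β _ hσ => norm_doubleSeries_term_le c hσ β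

lemma norm_doubleSeries_le {c : ℕ × ℕ → F} (hc : Summable fun β => ‖c β‖) (h0 : c 0 = 0)
    {σ : ℂ × ℂ} (hσ : σ ∈ closedBall (0 : ℂ × ℂ) 1) :
    ‖doubleSeries c σ‖ ≤ (∑' β, ‖c β‖) * ‖σ‖ := by
  refine tsum_of_norm_bounded (hc.hasSum.mul_right ‖σ‖) fun β => ?_
  rw [norm_smul]
  by_cases hβ : β = 0
  · simp [hβ, h0]
  · rw [mul_comm]
    gcongr
    exact norm_monomial_le_norm hσ hβ

lemma mem_ball_fst {σ : ℂ × ℂ} (hσ : σ ∈ ball (0 : ℂ × ℂ) 1) : σ.1 ∈ ball (0 : ℂ) 1 := by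
  rw [mem_ball_zero_iff] at hσ ⊢
  exact (norm_fst_le σ).trans_lt hσ

lemma mem_ball_snd {σ : ℂ × ℂ} (hσ : σ ∈ ball (0 : ℂ × ℂ) 1) : σ.2 ∈ ball (0 : ℂ) 1 := by
  rw [mem_ball_zero_iff] at hσ ⊢
  exact (norm_snd_le σ).trans_lt hσ

lemma doubleSeries_eq {c : ℕ × ℕ → F} (hc : Summable fun β => ‖c β‖) {σ : ℂ × ℂ}
    (hσ : σ ∈ ball (0 : ℂ × ℂ) 1) :
    seqPairing c hc (powSeq σ.1) (powSeq σ.2) = doubleSeries c σ := by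
  refine (hasSum_seqPairing hc _ _).unique ?_
  simp only [powSeq_apply (mem_ball_fst hσ), powSeq_apply (mem_ball_snd hσ)]
  exact hasSum_doubleSeries hc (ball_subset_closedBall hσ)

lemma eventuallyEq_doubleSeries {c : ℕ × ℕ → F} (hc : Summable fun β => ‖c β‖) {σ : ℂ × ℂ}
    (hσ : σ ∈ ball (0 : ℂ × ℂ) 1) :
    (fun σ => seqPairing c hc (powSeq σ.1) (powSeq σ.2)) =ᶠ[nhds σ] doubleSeries c := by
  filter_upwards [isOpen_ball.mem_nhds hσ] with τ hτ using doubleSeries_eq hc hτ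

lemma analyticOnNhd_doubleSeries {c : ℕ × ℕ → F} (hc : Summable fun β => ‖c β‖) :
    AnalyticOnNhd ℂ (doubleSeries c) (ball 0 1) := by
  intro σ hσ
  have hg := differentiableOn_powSeq.analyticOnNhd isOpen_ball
  have h1 : AnalyticAt ℂ (fun σ : ℂ × ℂ => powSeq σ.1) σ :=
    (hg _ (mem_ball_fst hσ)).comp analyticAt_fst
  have h2 : AnalyticAt ℂ (fun σ : ℂ × ℂ => powSeq σ.2) σ :=
    (hg _ (mem_ball_snd hσ)).comp analyticAt_snd
  exact (((seqPairing c hc).analyticAt_bilinear _).comp (h1.prod h2)).congr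
    (eventuallyEq_doubleSeries hc hσ)

/-- Termwise differentiation of a double power series. -/
lemma hasSum_fderiv_doubleSeries {c : ℕ × ℕ → F} (hc : Summable fun β => ‖c β‖) {σ : ℂ × ℂ}
    (hσ : σ ∈ ball (0 : ℂ × ℂ) 1) (v : ℂ × ℂ) :
    HasSum (fun β : ℕ × ℕ => (v.1 * (β.1 * σ.1 ^ (β.1 - 1)) * σ.2 ^ β.2 +
      σ.1 ^ β.1 * (v.2 * (β.2 * σ.2 ^ (β.2 - 1)))) • c β) (fderiv ℂ (doubleSeries c) σ v) := by
  have hd : ∀ z ∈ ball (0 : ℂ) 1, HasDerivAt powSeq (deriv powSeq z) z := fun z hz =>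
    (differentiableOn_powSeq.differentiableAt (isOpen_ball.mem_nhds hz)).hasDerivAt
  have h1 := (hd _ (mem_ball_fst hσ)).hasFDerivAt.comp σ (hasFDerivAt_fst (p := σ))
  have h2 := (hd _ (mem_ball_snd hσ)).hasFDerivAt.comp σ (hasFDerivAt_snd (p := σ))
  have h3 := (seqPairing c hc).hasFDerivAt_of_bilinear h1 h2
  have h4 := (h3.congr_of_eventuallyEq (eventuallyEq_doubleSeries hc hσ).symm).fderiv
  rw [h4]
  have h5 := (hasSum_seqPairing hc (v.1 • deriv powSeq σ.1) (powSeq σ.2)).add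
    (hasSum_seqPairing hc (powSeq σ.1) (v.2 • deriv powSeq σ.2))
  convert h5 using 1
  · funext β
    rw [← add_smul]
    simp [powSeq_apply (mem_ball_fst hσ), powSeq_apply (mem_ball_snd hσ),
      deriv_powSeq_apply (mem_ball_fst hσ), deriv_powSeq_apply (mem_ball_snd hσ)]
  · simp [add_comm]

lemma fderiv_doubleSeries_zero {c : ℕ × ℕ → F} (hc : Summable fun β => ‖c β‖) (v : ℂ × ℂ) :
    fderiv ℂ (doubleSeries c) 0 v = v.1 • c (1, 0) + v.2 • c (0, 1) := by
  have h1 := hasSum_fderiv_doubleSeries hc (σ := 0) (by simp) v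
  have h2 := hasSum_sum_of_ne_finset_zero (s := {((1 : ℕ), (0 : ℕ)), (0, 1)})
    (f := fun β : ℕ × ℕ => (v.1 * (β.1 * (0 : ℂ) ^ (β.1 - 1)) * (0 : ℂ) ^ β.2 +
      (0 : ℂ) ^ β.1 * (v.2 * (β.2 * (0 : ℂ) ^ (β.2 - 1)))) • c β) (L := .unconditional _) (by
    rintro ⟨i, j⟩ hij
    simp only [Finset.mem_insert, Finset.mem_singleton, Prod.mk.injEq, not_or] at hij
    -- For `i = 0` the truncated exponent gives `0 ^ 0 = 1`, and the factor `i` makes the term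
    -- vanish.
    have e1 : v.1 * ((i : ℂ) * (0 : ℂ) ^ (i - 1)) * (0 : ℂ) ^ j = 0 := by
      rcases Nat.eq_zero_or_pos j with rfl | hj
      · rcases Nat.lt_trichotomy i 1 with h | h | h
        · simp [Nat.lt_one_iff.1 h]
        · exact absurd ⟨h, rfl⟩ hij.1
        · simp [zero_pow (show i - 1 ≠ 0 by omega)]
      · simp [zero_pow hj.ne']
    have e2 : (0 : ℂ) ^ i * (v.2 * ((j : ℂ) * (0 : ℂ) ^ (j - 1))) = 0 := by
      rcases Nat.eq_zero_or_pos i with rfl | hi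
      · rcases Nat.lt_trichotomy j 1 with h | h | h
        · simp [Nat.lt_one_iff.1 h]
        · exact absurd ⟨rfl, h⟩ hij.2
        · simp [zero_pow (show j - 1 ≠ 0 by omega)]
      · simp [zero_pow hi.ne']
    rw [e1, e2, add_zero, zero_smul])
  rw [h1.unique h2, Finset.sum_pair (by simp)]
  simp

/-- The derivative of a double power series along the linear vector field. -/
lemma hasSum_fderiv_doubleSeries_pairing {c : ℕ × ℕ → F} (hc : Summable fun β => ‖c β‖)
    {σ : ℂ × ℂ} (hσ : σ ∈ ball (0 : ℂ × ℂ) 1) (l : ℂ × ℂ) :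
    HasSum (fun β : ℕ × ℕ => (pairing l β * (σ.1 ^ β.1 * σ.2 ^ β.2)) • c β)
      (fderiv ℂ (doubleSeries c) σ (l.1 * σ.1, l.2 * σ.2)) := by
  convert hasSum_fderiv_doubleSeries hc hσ (l.1 * σ.1, l.2 * σ.2) using 3 with β
  have e : ∀ (z : ℂ) (k : ℕ), z * (k * z ^ (k - 1)) = k * z ^ k := by
    intro z k
    rcases Nat.eq_zero_or_pos k with rfl | hk
    · simp
    · rw [mul_left_comm, mul_pow_sub_one hk.ne']
  calc pairing l β * (σ.1 ^ β.1 * σ.2 ^ β.2)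
      = l.1 * (β.1 * σ.1 ^ β.1) * σ.2 ^ β.2 + σ.1 ^ β.1 * (l.2 * (β.2 * σ.2 ^ β.2)) := by
        rw [pairing]; ring
    _ = _ := by rw [← e, ← e]; ring

/-- The Cauchy product of double series. -/
lemma hasSum_conv {x y : ℕ × ℕ → ℂ} (hx : Summable fun β => ‖x β‖) (hy : Summable fun β => ‖y β‖) :
    HasSum (conv x y) ((∑' β, x β) * ∑' β, y β) := by
  -- Presents the sum over `b ≤ β` as a sum over an antidiagonal, so that the general Cauchy product
  -- theorem applies.
  let _ : Finset.HasAntidiagonal (ℕ × ℕ) :=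
    { antidiagonal := fun β => (Finset.Iic β).image fun b => (b, β - b)
      mem_antidiagonal := by
        rintro β ⟨b, b'⟩
        simp only [Finset.mem_image, Finset.mem_Iic, Prod.mk.injEq]
        constructor
        · rintro ⟨b, hb, rfl, rfl⟩
          exact add_tsub_cancel_of_le hb
        · rintro rfl
          exact ⟨b, le_self_add, rfl, add_tsub_cancel_left _ _⟩ }
  have hconv : conv x y = fun β => ∑ b ∈ Finset.HasAntidiagonal.antidiagonal β, x b.1 * y b.2 := by
    funext β
    have hinj : Set.InjOn (fun b : ℕ × ℕ => (b, β - b)) (Finset.Iic β) :=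
      fun b _ b' _ h => (Prod.ext_iff.1 h).1
    exact (Finset.sum_image (f := fun b : (ℕ × ℕ) × ℕ × ℕ => x b.1 * y b.2) hinj).symm
  have hxy := summable_mul_of_summable_norm hx hy
  rw [hx.of_norm.tsum_mul_tsum_eq_tsum_sum_antidiagonal hy.of_norm hxy, hconv]
  exact (summable_sum_mul_antidiagonal_of_summable_mul hxy).hasSum

end DoublePowerSeries

/-! ## The linearization of the pseudospectral Wright equation -/

section Linearization

set_option linter.unusedSectionVars false

open Polynomial Module

variable {α : ℝ} {n : ℕ} [NeZero n] {l : ℂ × ℂ}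

/-- `A_n` as a continuous linear map. -/
def wrightCLM (α : ℝ) (n : ℕ) [NeZero n] : (ℂ × (Fin n → ℂ)) →L[ℂ] (ℂ × (Fin n → ℂ)) :=
  LinearMap.toContinuousLinearMap (wrightLin α n)

lemma wrightCLM_apply (x : ℂ × (Fin n → ℂ)) : wrightCLM α n x = wrightLin α n x := rfl

lemma aeval_wrightCLM (q : ℂ[X]) (x : ℂ × (Fin n → ℂ)) :
    aeval (wrightCLM α n) q x = aeval (wrightLin α n) q x := by
  have h1 : wrightCLM α n = Module.End.toContinuousLinearMap _ (wrightLin α n) := rfl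
  rw [h1, aeval_algEquiv]
  rfl

/-- The eigenvalues of `A_n` outside the open right half plane. -/
def stableRoots (α : ℝ) (n : ℕ) [NeZero n] : Multiset ℂ :=
  (wrightLin α n).charpoly.roots.filter (fun z : ℂ => ¬ 0 < z.re)

lemma re_nonpos_of_mem_stableRoots {ν : ℂ} (h : ν ∈ stableRoots α n) : ν.re ≤ 0 :=
  not_lt.1 (Multiset.mem_filter.1 h).2

lemma charpoly_eq
    (heig : (wrightLin α n).charpoly.roots.filter (fun z : ℂ => 0 < z.re) = {l.1, l.2}) :
    (wrightLin α n).charpoly =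
      (X - C l.1) * (X - C l.2) * ((stableRoots α n).map (fun ν => X - C ν)).prod := by
  have h1 := (IsAlgClosed.splits (wrightLin α n).charpoly).eq_prod_roots
  rw [(LinearMap.charpoly_monic _).leadingCoeff, C_1, one_mul,
    ← Multiset.filter_add_not (fun z : ℂ => 0 < z.re) (wrightLin α n).charpoly.roots, heig] at h1
  rw [h1, Multiset.map_add, Multiset.prod_add]
  simp [stableRoots]

lemma aeval_wrightCLM_eq_zero
    (heig : (wrightLin α n).charpoly.roots.filter (fun z : ℂ => 0 < z.re) = {l.1, l.2}) :
    aeval (wrightCLM α n)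
      ((X - C l.1) * (X - C l.2) * ((stableRoots α n).map (fun ν => X - C ν)).prod) = 0 := by
  refine ContinuousLinearMap.ext fun x => ?_
  rw [← charpoly_eq heig, aeval_wrightCLM, LinearMap.aeval_self_charpoly]
  rfl

lemma isUnit_of_notMem_spectrum {z : ℂ} (hz : z ∉ spectrum ℂ (diffMatrixOver ℂ n)) :
    IsUnit (diffMatrixOver ℂ n - z • (1 : Matrix (Fin n) (Fin n) ℂ)) := by
  rw [spectrum.notMem_iff, Algebra.algebraMap_eq_smul_one] at hz
  rw [← neg_sub]
  exact hz.neg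

/-- The defining equation of `(D - z I)⁻¹ D 𝟏`. -/
lemma mulVec_blowup {z : ℂ} (hz : z ∉ spectrum ℂ (diffMatrixOver ℂ n)) :
    (diffMatrixOver ℂ n).mulVec (blowup n z) - diffOne ℂ n = z • blowup n z := by
  have hu := isUnit_of_notMem_spectrum hz
  have h1 : (diffMatrixOver ℂ n - z • (1 : Matrix (Fin n) (Fin n) ℂ)).mulVec (blowup n z) =
      diffOne ℂ n := by
    rw [blowup, Matrix.mulVec_mulVec, Matrix.mul_nonsing_inv _ (Matrix.isUnit_iff_isUnit_det _ |>.1 hu),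
      Matrix.one_mulVec]
  rw [Matrix.sub_mulVec, Matrix.smul_mulVec, Matrix.one_mulVec] at h1
  rw [← h1]
  abel

lemma eq_blowup {z : ℂ} (hz : z ∉ spectrum ℂ (diffMatrixOver ℂ n)) {a : ℂ} {y : Fin n → ℂ}
    (h : (diffMatrixOver ℂ n).mulVec y - a • diffOne ℂ n = z • y) : y = a • blowup n z := by
  have hu := isUnit_of_notMem_spectrum hz
  have h1 : (diffMatrixOver ℂ n - z • (1 : Matrix (Fin n) (Fin n) ℂ)).mulVec y =
      a • diffOne ℂ n := by
    rw [Matrix.sub_mulVec, Matrix.smul_mulVec, Matrix.one_mulVec, ← h]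
    abel
  rw [blowup, ← Matrix.mulVec_smul, ← h1, Matrix.mulVec_mulVec,
    Matrix.nonsing_inv_mul _ (Matrix.isUnit_iff_isUnit_det _ |>.1 hu), Matrix.one_mulVec]

/-- For an eigenvector `(y₀, y)` the second component forces `y = y₀ • blowup n z`; thus `y₀ ≠ 0`,
and the first component becomes `y₀ Δ_n(z) = 0`. -/
lemma charFn_eq_zero {z : ℂ} (hz : z ∉ spectrum ℂ (diffMatrixOver ℂ n))
    (hroot : z ∈ (wrightLin α n).charpoly.roots) : charFn α n z = 0 := by
  have h1 : Module.End.HasEigenvalue (wrightLin α n) z := by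
    rw [Module.End.hasEigenvalue_iff_isRoot_charpoly]
    exact isRoot_of_mem_roots hroot
  obtain ⟨x, hx⟩ := h1.exists_hasEigenvector
  have h2 := hx.apply_eq_smul
  have h3 := eq_blowup hz (congrArg Prod.snd h2)
  have h4 : -(α : ℂ) * x.2 (lastIdx n) = z * x.1 := congrArg Prod.fst h2
  have hx1 : x.1 ≠ 0 := by
    intro h0
    rw [h0, zero_smul] at h3
    exact hx.2 (Prod.ext h0 h3)
  rw [h3, Pi.smul_apply, smul_eq_mul] at h4
  have h5 : x.1 * charFn α n z = 0 := by
    rw [charFn]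
    linear_combination -h4
  exact (mul_eq_zero.1 h5).resolve_left hx1

/-- The eigenvectors `(1, (D - z I)⁻¹ D 𝟏)`. -/
lemma wrightLin_blowup {z : ℂ} (hz : z ∉ spectrum ℂ (diffMatrixOver ℂ n))
    (h : charFn α n z = 0) :
    wrightLin α n ((1 : ℂ), blowup n z) = z • ((1 : ℂ), blowup n z) := by
  refine Prod.ext ?_ ?_
  · change -(α : ℂ) * blowup n z (lastIdx n) = z * 1
    rw [charFn] at h
    linear_combination -h
  · change (diffMatrixOver ℂ n).mulVec (blowup n z) - (1 : ℂ) • diffOne ℂ n = z • blowup n z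
    rw [one_smul, mulVec_blowup hz]

/-! ### The unstable subspace and the stable factor of the characteristic polynomial. -/

section

variable (hne : l.1 ≠ l.2)
    (heig : (wrightLin α n).charpoly.roots.filter (fun z : ℂ => 0 < z.re) = {l.1, l.2})
    (h₁ : l.1 ∉ spectrum ℂ (diffMatrixOver ℂ n)) (h₂ : l.2 ∉ spectrum ℂ (diffMatrixOver ℂ n))

include heig

lemma mem_roots_of_mem {z : ℂ} (hz : z = l.1 ∨ z = l.2) :
    z ∈ (wrightLin α n).charpoly.roots ∧ 0 < z.re := by
  have : z ∈ (wrightLin α n).charpoly.roots.filter (fun z : ℂ => 0 < z.re) := by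
    rw [heig]; simpa using hz
  exact Multiset.mem_filter.1 this

include hne

/-- The root `z` is simple since `l.1 ≠ l.2`, so the generalized eigenspace has dimension one and
the known eigenvector spans it. -/
lemma maxGenEigenspace_eq_span {z : ℂ} (hz : z = l.1 ∨ z = l.2)
    (hzD : z ∉ spectrum ℂ (diffMatrixOver ℂ n)) :
    Module.End.maxGenEigenspace (wrightLin α n) z = Submodule.span ℂ {((1 : ℂ), blowup n z)} := by
  obtain ⟨hroot, hre⟩ := mem_roots_of_mem heig hz
  symm
  refine Submodule.eq_of_le_of_finrank_eq ?_ ?_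
  · rw [Submodule.span_singleton_le_iff_mem]
    refine (End.genEigenspace_le_maximal (wrightLin α n) z 1) ?_
    have := wrightLin_blowup hzD (charFn_eq_zero hzD hroot)
    simpa [End.mem_eigenspace_iff] using this
  · rw [LinearMap.finrank_maxGenEigenspace_eq, ← count_roots,
      finrank_span_singleton (by simp [Prod.ext_iff])]
    have h1 : ((wrightLin α n).charpoly.roots.filter (fun z : ℂ => 0 < z.re)).count z =
        (wrightLin α n).charpoly.roots.count z := Multiset.count_filter_of_pos hre
    rw [← h1, heig]
    have hnd : ({l.1, l.2} : Multiset ℂ).Nodup := by simpa using hne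
    exact (Multiset.count_eq_one_of_mem hnd (by simpa using hz)).symm

include h₁ h₂

lemma unstableSubspace_eq_span :
    unstableSubspace α n =
      Submodule.span ℂ {((1 : ℂ), blowup n l.1), ((1 : ℂ), blowup n l.2)} := by
  rw [Submodule.span_insert, ← maxGenEigenspace_eq_span hne heig (Or.inl rfl) h₁,
    ← maxGenEigenspace_eq_span hne heig (Or.inr rfl) h₂]
  apply le_antisymm
  · refine iSup₂_le fun μ hμ => ?_
    by_cases hμl : μ = l.1 ∨ μ = l.2
    · rcases hμl with rfl | rfl
      · exact le_sup_left
      · exact le_sup_right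
    · have : Module.End.maxGenEigenspace (wrightLin α n) μ = ⊥ := by
        rw [← Submodule.finrank_eq_zero (R := ℂ), LinearMap.finrank_maxGenEigenspace_eq,
          ← count_roots, Multiset.count_eq_zero]
        intro hmem
        have : μ ∈ (wrightLin α n).charpoly.roots.filter (fun z : ℂ => 0 < z.re) :=
          Multiset.mem_filter.2 ⟨hmem, hμ⟩
        rw [heig] at this
        exact hμl (by simpa using this)
      rw [this]
      exact bot_le
  · exact sup_le (le_iSup₂_of_le l.1 (mem_roots_of_mem heig (Or.inl rfl)).2 le_rfl)
      (le_iSup₂_of_le l.2 (mem_roots_of_mem heig (Or.inr rfl)).2 le_rfl)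

lemma exists_of_mem_unstableSubspace {x : ℂ × (Fin n → ℂ)} (hx : x ∈ unstableSubspace α n) :
    ∃ a b : ℂ, x = a • ((1 : ℂ), blowup n l.1) + b • ((1 : ℂ), blowup n l.2) := by
  rw [unstableSubspace_eq_span hne heig h₁ h₂, Submodule.mem_span_pair] at hx
  obtain ⟨a, b, h⟩ := hx
  exact ⟨a, b, h.symm⟩

/-- The stable factor of the characteristic polynomial maps into the unstable subspace. -/
lemma aeval_mem_unstableSubspace (x : ℂ × (Fin n → ℂ)) :
    aeval (wrightCLM α n) ((stableRoots α n).map (fun ν => X - C ν)).prod x ∈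
      unstableSubspace α n := by
  set q := ((stableRoots α n).map (fun ν => X - C ν)).prod with hq
  set y := aeval (wrightCLM α n) q x with hy
  -- `A - z` kills `(A - w) y`, which is therefore in the eigenspace of `z`. The difference of the
  -- two instances is `(l.1 - l.2) • y`.
  have hmem : ∀ z w : ℂ, 0 < z.re → aeval (wrightCLM α n) ((X - C z) * (X - C w) * q) = 0 →
      wrightLin α n y - w • y ∈ unstableSubspace α n := by
    intro z w hz h0
    have h1 := congrArg (fun B : (ℂ × (Fin n → ℂ)) →L[ℂ] (ℂ × (Fin n → ℂ)) => B x) h0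
    simp only [map_mul, mul_apply_eq_comp, aeval_X_sub_C_apply] at h1
    refine (le_iSup₂_of_le z hz le_rfl : Module.End.maxGenEigenspace (wrightLin α n) z ≤ _) ?_
    refine (End.genEigenspace_le_maximal (wrightLin α n) z 1) ?_
    have h2 := sub_eq_zero.1 h1
    exact End.mem_eigenspace_iff.2 h2
  have hA := aeval_wrightCLM_eq_zero heig
  have e1 := hmem l.1 l.2 (mem_roots_of_mem heig (Or.inl rfl)).2 hA
  have e2 := hmem l.2 l.1 (mem_roots_of_mem heig (Or.inr rfl)).2 (by
    rw [mul_comm (X - C l.2)]; exact hA)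
  have h3 := (unstableSubspace α n).smul_mem (l.1 - l.2)⁻¹
    ((unstableSubspace α n).sub_mem e1 e2)
  have hne' : l.1 - l.2 ≠ 0 := sub_ne_zero.2 hne
  convert h3 using 1
  rw [sub_sub_sub_cancel_left, ← sub_smul, smul_smul, inv_mul_cancel₀ hne', one_smul]

/-- The two unstable eigenvectors are linearly independent. -/
lemma eq_zero_of_smul_add_smul_eq_zero {a b : ℂ}
    (h0 : a • ((1 : ℂ), blowup n l.1) + b • ((1 : ℂ), blowup n l.2) = 0) : a = 0 ∧ b = 0 := by
  have h3 := congrArg (wrightLin α n) h0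
  rw [map_add, map_smul, map_smul, map_zero,
    wrightLin_blowup h₁ (charFn_eq_zero h₁ (mem_roots_of_mem heig (Or.inl rfl)).1),
    wrightLin_blowup h₂ (charFn_eq_zero h₂ (mem_roots_of_mem heig (Or.inr rfl)).1)] at h3
  have f0 := congrArg Prod.fst h0
  have f3 := congrArg Prod.fst h3
  simp only [Prod.fst_add, Prod.smul_fst, smul_eq_mul, mul_one, Prod.fst_zero] at f0 f3
  have ha : a * (l.1 - l.2) = 0 := by linear_combination f3 - l.2 * f0
  have hb : b * (l.1 - l.2) = 0 := by linear_combination l.1 * f0 - f3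
  have hne' : l.1 - l.2 ≠ 0 := sub_ne_zero.2 hne
  exact ⟨(mul_eq_zero.1 ha).resolve_right hne', (mul_eq_zero.1 hb).resolve_right hne'⟩

/-- On the eigenvectors `q(A)` acts by the scalars `q(l.1)` and `q(l.2)`, nonzero because the roots
of `q` have nonpositive real part. -/
lemma aeval_inj_unstableSubspace {x : ℂ × (Fin n → ℂ)} (hx : x ∈ unstableSubspace α n)
    (h0 : aeval (wrightCLM α n) ((stableRoots α n).map (fun ν => X - C ν)).prod x = 0) :
    x = 0 := by
  obtain ⟨a, b, rfl⟩ := exists_of_mem_unstableSubspace hne heig h₁ h₂ hx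
  set q := ((stableRoots α n).map (fun ν => X - C ν)).prod with hq
  have hev : ∀ z : ℂ, (z = l.1 ∨ z = l.2) → z ∉ spectrum ℂ (diffMatrixOver ℂ n) →
      aeval (wrightCLM α n) q ((1 : ℂ), blowup n z) = q.eval z • ((1 : ℂ), blowup n z) ∧
      q.eval z ≠ 0 := by
    intro z hz hzD
    obtain ⟨hroot, hre⟩ := mem_roots_of_mem heig hz
    have h1 := wrightLin_blowup hzD (charFn_eq_zero hzD hroot)
    refine ⟨?_, ?_⟩
    · rw [aeval_wrightCLM]
      exact End.aeval_apply_of_hasEigenvector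
        ⟨End.mem_eigenspace_iff.2 h1, by simp [Prod.ext_iff]⟩
    · rw [hq, eval_multiset_prod, Multiset.map_map]
      intro h2
      rw [Multiset.prod_eq_zero_iff, Multiset.mem_map] at h2
      obtain ⟨ν, hν, hν0⟩ := h2
      have h3 := re_nonpos_of_mem_stableRoots hν
      simp only [Function.comp_apply, eval_sub, eval_X, eval_C] at hν0
      rw [sub_eq_zero.1 hν0] at hre
      linarith
  obtain ⟨a2, a3⟩ := hev l.1 (Or.inl rfl) h₁
  obtain ⟨b2, b3⟩ := hev l.2 (Or.inr rfl) h₂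
  rw [map_add, map_smul, map_smul, a2, b2, smul_smul, smul_smul] at h0
  obtain ⟨ha, hb⟩ := eq_zero_of_smul_add_smul_eq_zero hne heig h₁ h₂ h0
  rw [(mul_eq_zero.1 ha).resolve_right a3, (mul_eq_zero.1 hb).resolve_right b3, zero_smul,
    zero_smul, add_zero]

end

/-! ### Complex conjugation -/

/-- Complex conjugation on `ℂ × ℂⁿ`. -/
def conjCLM (n : ℕ) : (ℂ × (Fin n → ℂ)) →L[ℝ] (ℂ × (Fin n → ℂ)) :=
  (Complex.conjCLE.toContinuousLinearMap.comp (ContinuousLinearMap.fst ℝ ℂ (Fin n → ℂ))).prod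
    (ContinuousLinearMap.pi fun i => Complex.conjCLE.toContinuousLinearMap.comp
      ((ContinuousLinearMap.proj i).comp (ContinuousLinearMap.snd ℝ ℂ (Fin n → ℂ))))

lemma conjCLM_apply (x : ℂ × (Fin n → ℂ)) :
    conjCLM n x = (starRingEnd ℂ x.1, fun i => starRingEnd ℂ (x.2 i)) := rfl

lemma conjCLM_smul (z : ℂ) (x : ℂ × (Fin n → ℂ)) :
    conjCLM n (z • x) = starRingEnd ℂ z • conjCLM n x := by
  simp only [conjCLM_apply, Prod.smul_mk, Prod.smul_fst, Prod.smul_snd, smul_eq_mul, map_mul,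
    Pi.smul_apply]
  rfl

lemma norm_conjCLM (x : ℂ × (Fin n → ℂ)) : ‖conjCLM n x‖ = ‖x‖ := by
  simp [conjCLM_apply, Prod.norm_def, Pi.norm_def, nnnorm]

lemma conj_diffMatrix_mulVec (y : Fin n → ℂ) (i : Fin n) :
    starRingEnd ℂ ((diffMatrixOver ℂ n).mulVec y i) =
      (diffMatrixOver ℂ n).mulVec (fun j => starRingEnd ℂ (y j)) i := by
  simp [Matrix.mulVec, dotProduct, diffMatrixOver]

lemma conj_diffOne (i : Fin n) : starRingEnd ℂ (diffOne ℂ n i) = diffOne ℂ n i := by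
  rw [diffOne, conj_diffMatrix_mulVec]
  simp

lemma conjCLM_wrightLin (x : ℂ × (Fin n → ℂ)) :
    conjCLM n (wrightLin α n x) = wrightLin α n (conjCLM n x) := by
  refine Prod.ext ?_ ?_
  · change starRingEnd ℂ (-(α : ℂ) * x.2 (lastIdx n)) = -(α : ℂ) * starRingEnd ℂ (x.2 (lastIdx n))
    simp
  · funext i
    change starRingEnd ℂ ((diffMatrixOver ℂ n).mulVec x.2 i - x.1 * diffOne ℂ n i) =
      (diffMatrixOver ℂ n).mulVec (fun j => starRingEnd ℂ (x.2 j)) i -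
        starRingEnd ℂ x.1 * diffOne ℂ n i
    rw [map_sub, map_mul, conj_diffMatrix_mulVec, conj_diffOne]

/-- The matrix of `A_n` in the standard basis is real. -/
lemma charpoly_map_conj :
    (wrightLin α n).charpoly.map (starRingEnd ℂ) = (wrightLin α n).charpoly := by
  set b : Basis (Unit ⊕ Fin n) ℂ (ℂ × (Fin n → ℂ)) :=
    (Basis.singleton Unit ℂ).prod (Pi.basisFun ℂ (Fin n)) with hb
  have hrepr : ∀ x i, starRingEnd ℂ (b.repr x i) = b.repr (conjCLM n x) i := by
    rintro x (i | i)
    · simp [hb, conjCLM_apply]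
    · simp [hb, conjCLM_apply]
  have hfix : ∀ j, conjCLM n (b j) = b j := by
    rintro (j | j)
    · refine Prod.ext ?_ ?_
      · simp [hb, conjCLM_apply]
      · funext k
        simp [hb, conjCLM_apply]
    · refine Prod.ext ?_ ?_
      · simp [hb, conjCLM_apply]
      · funext k
        simp [hb, conjCLM_apply, Pi.single_apply, apply_ite (starRingEnd ℂ)]
  have hM : (LinearMap.toMatrix b b (wrightLin α n)).map (starRingEnd ℂ) =
      LinearMap.toMatrix b b (wrightLin α n) := by
    ext i j
    rw [Matrix.map_apply, LinearMap.toMatrix_apply, hrepr, conjCLM_wrightLin, hfix]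
  rw [← LinearMap.charpoly_toMatrix (wrightLin α n) b, ← Matrix.charpoly_map, hM]

/-- Conjugation permutes the roots of a real polynomial and preserves real parts. With
`conjCLM_aeval` this makes `q(A)` commute with conjugation. -/
lemma stableRoots_map_conj : (stableRoots α n).map (starRingEnd ℂ) = stableRoots α n := by
  have h1 : (wrightLin α n).charpoly.roots.map (starRingEnd ℂ) =
      (wrightLin α n).charpoly.roots := by
    conv_rhs => rw [← charpoly_map_conj]
    exact ((IsAlgClosed.splits _).roots_map _).symm
  rw [stableRoots]
  conv_rhs => rw [← h1]
  rw [Multiset.filter_map]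
  simp only [Function.comp_def, Complex.conj_re]

lemma conjCLM_aeval (s : Multiset ℂ) : ∀ x : ℂ × (Fin n → ℂ),
    conjCLM n (aeval (wrightCLM α n) (s.map (fun ν => X - C ν)).prod x) =
      aeval (wrightCLM α n) ((s.map (starRingEnd ℂ)).map (fun ν => X - C ν)).prod
        (conjCLM n x) := by
  induction s using Multiset.induction with
  | empty => intro x; simp
  | cons ν s ih =>
    intro x
    simp only [Multiset.map_cons, Multiset.prod_cons, map_mul, mul_apply_eq_comp,
      aeval_X_sub_C_apply]
    rw [map_sub, wrightCLM_apply, conjCLM_wrightLin, conjCLM_smul, ih, wrightCLM_apply]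

end Linearization

/-! ## The parametrization -/

section Wright

set_option linter.unusedSectionVars false

open Polynomial Set Metric

variable {α : ℝ} {n : ℕ} [NeZero n] {l : ℂ × ℂ} {p : ℕ × ℕ → ℂ}

/-- The nonlinear part of the vector field. -/
def wrightNonlin (α : ℝ) (n : ℕ) [NeZero n] (y : ℂ × (Fin n → ℂ)) : ℂ × (Fin n → ℂ) :=
  (-(α : ℂ) * y.2 (lastIdx n) * y.1, 0)

lemma wrightField_eq :
    wrightField ℂ α n = fun y => wrightCLM α n y + wrightNonlin α n y := by
  funext y
  refine Prod.ext ?_ ?_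
  · change -(α : ℂ) * y.2 (lastIdx n) * (1 + y.1) =
      -(α : ℂ) * y.2 (lastIdx n) + -(α : ℂ) * y.2 (lastIdx n) * y.1
    ring
  · change _ = (_ : Fin n → ℂ) + 0
    rw [add_zero]
    rfl

lemma norm_wrightNonlin_sub_le (x y : ℂ × (Fin n → ℂ)) :
    ‖wrightNonlin α n x - wrightNonlin α n y‖ ≤ |α| * (‖x‖ + ‖y‖) * ‖x - y‖ := by
  have hsnd : ∀ z : ℂ × (Fin n → ℂ), ‖z.2 (lastIdx n)‖ ≤ ‖z‖ := fun z =>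
    (norm_le_pi_norm z.2 _).trans (norm_snd_le z)
  have h1 : wrightNonlin α n x - wrightNonlin α n y =
      (-(α : ℂ) * (x.2 (lastIdx n) * (x - y).1 + (x - y).2 (lastIdx n) * y.1), 0) := by
    refine Prod.ext ?_ ?_
    · change -(α : ℂ) * x.2 (lastIdx n) * x.1 - -(α : ℂ) * y.2 (lastIdx n) * y.1 =
        -(α : ℂ) * (x.2 (lastIdx n) * (x.1 - y.1) + (x.2 (lastIdx n) - y.2 (lastIdx n)) * y.1)
      ring
    · exact sub_zero _
  rw [h1, Prod.norm_def, norm_zero, max_eq_left (norm_nonneg _), norm_mul, norm_neg,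
    Complex.norm_real, Real.norm_eq_abs, mul_assoc]
  gcongr
  calc ‖x.2 (lastIdx n) * (x - y).1 + (x - y).2 (lastIdx n) * y.1‖
      ≤ ‖x.2 (lastIdx n)‖ * ‖(x - y).1‖ + ‖(x - y).2 (lastIdx n)‖ * ‖y.1‖ := by
        rw [← norm_mul, ← norm_mul]; exact norm_add_le _ _
    _ ≤ ‖x‖ * ‖x - y‖ + ‖x - y‖ * ‖y‖ := by
        gcongr
        · exact hsnd x
        · exact norm_fst_le _
        · exact hsnd _
        · exact norm_fst_le _
    _ = _ := by ring

/-- The coefficients of the parametrization. -/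
def paramCoeff (n : ℕ) (l : ℂ × ℂ) (p : ℕ × ℕ → ℂ) (β : ℕ × ℕ) : ℂ × (Fin n → ℂ) :=
  p β • ((1 : ℂ), blowup n (pairing l β))

lemma paramTerm_eq (σ : ℂ × ℂ) (β : ℕ × ℕ) :
    paramTerm n l p σ β = (σ.1 ^ β.1 * σ.2 ^ β.2) • paramCoeff n l p β := by
  rw [paramTerm, paramCoeff, smul_smul, mul_comm]

lemma paramMap_eq : paramMap n l p = doubleSeries (paramCoeff n l p) := by
  funext σ
  simp only [paramMap, doubleSeries, paramTerm_eq]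

lemma pairing_re_ge {m : ℝ} (h₁ : m ≤ l.1.re) (h₂ : m ≤ l.2.re) (β : ℕ × ℕ) :
    m * (β.1 + β.2) ≤ (pairing l β).re := by
  have : (pairing l β).re = l.1.re * β.1 + l.2.re * β.2 := by simp [pairing]
  rw [this, mul_add]
  gcongr

/-- From `D b - D 𝟏 = z b` follows `(|z| - ‖D‖) ‖b‖ ≤ ‖D 𝟏‖`, so `‖b‖ ≤ ‖D 𝟏‖` once `|z| ≥ ‖D‖ + 1`.
As `Re ⟨λ, β⟩ ≥ m |β|` with `m > 0`, only finitely many `β` escape. -/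
lemma summable_paramCoeff (h₁ : 0 < l.1.re) (h₂ : 0 < l.2.re)
    (hD : ∀ β : ℕ × ℕ, 1 ≤ β.1 + β.2 → pairing l β ∉ spectrum ℂ (diffMatrixOver ℂ n))
    (hsum : Summable fun β => ‖p β‖) : Summable fun β => ‖paramCoeff n l p β‖ := by
  set L : (Fin n → ℂ) →L[ℂ] (Fin n → ℂ) :=
    LinearMap.toContinuousLinearMap (diffMatrixOver ℂ n).mulVecLin with hL
  set m := min l.1.re l.2.re with hm_def
  have hm : 0 < m := lt_min h₁ h₂
  have hev : ∀ᶠ β : ℕ × ℕ in Filter.cofinite, ‖L‖ + 1 ≤ m * (β.1 + β.2) ∧ 1 ≤ β.1 + β.2 := by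
    obtain ⟨k, hk⟩ := exists_nat_gt ((‖L‖ + 1) / m)
    refine ((Finset.range (k + 1) ×ˢ Finset.range (k + 1)).finite_toSet).subset ?_
    intro β hβ
    by_contra hnot
    apply hβ
    have hkβ : k + 1 ≤ β.1 + β.2 := by
      simp only [Finset.coe_product, Finset.coe_range, mem_prod, mem_Iio, not_and_or, not_lt]
        at hnot
      omega
    refine ⟨?_, by omega⟩
    rw [div_lt_iff₀ hm] at hk
    have h3 : ((k + 1 : ℕ) : ℝ) ≤ ((β.1 + β.2 : ℕ) : ℝ) := by exact_mod_cast hkβ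
    push_cast at h3
    nlinarith
  refine Summable.of_norm_bounded_eventually (hsum.mul_left (max 1 ‖diffOne ℂ n‖)) ?_
  filter_upwards [hev] with β hβ
  have hz := mulVec_blowup (hD β hβ.2)
  set b := blowup n (pairing l β) with hb
  have hzn : ‖L‖ + 1 ≤ ‖pairing l β‖ :=
    hβ.1.trans ((pairing_re_ge (min_le_left _ _) (min_le_right _ _) β).trans
      ((le_abs_self _).trans (Complex.abs_re_le_norm _)))
  have h3 : ‖pairing l β‖ * ‖b‖ ≤ ‖L‖ * ‖b‖ + ‖diffOne ℂ n‖ := by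
    rw [← norm_smul, ← hz]
    refine (norm_sub_le _ _).trans ?_
    gcongr
    exact L.le_opNorm b
  have h4 : ‖b‖ ≤ ‖diffOne ℂ n‖ := by nlinarith [norm_nonneg b]
  rw [norm_norm, paramCoeff, norm_smul, mul_comm]
  gcongr
  rw [Prod.norm_def]
  simp only [norm_one]
  exact max_le_max le_rfl h4

section

variable {ξ : ℕ × ℕ → ℂ} (h₁ : l.1 ∈ (wrightLin α n).charpoly.roots)
    (h₂ : l.2 ∈ (wrightLin α n).charpoly.roots)
    (hD : ∀ β : ℕ × ℕ, 1 ≤ β.1 + β.2 → pairing l β ∉ spectrum ℂ (diffMatrixOver ℂ n))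
    (hp : zeroMap α n l ξ p = 0)

include hp in
lemma coeff_zero : p 0 = 0 := by
  simpa [zeroMap] using congrFun hp 0

include hp in
lemma coeff_one {β : ℕ × ℕ} (hβ : β.1 + β.2 = 1) : p β = ξ β := by
  have := congrFun hp β
  simp only [zeroMap, hβ, one_ne_zero, if_false, if_true, Pi.zero_apply] at this
  exact sub_eq_zero.1 this

include h₁ h₂ hD hp

/-- The recursion satisfied by the coefficients. -/
lemma coeff_recursion (β : ℕ × ℕ) :
    -(α : ℂ) * rOp n l p β + -(α : ℂ) * conv p (rOp n l p) β = pairing l β * p β := by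
  have hp0 := coeff_zero hp
  rcases Nat.lt_trichotomy (β.1 + β.2) 1 with h | h | h
  · have hβ : β = 0 := Prod.ext (by simp; omega) (by simp; omega)
    subst hβ
    have h0 : Finset.Iic (0 : ℕ × ℕ) = {0} := by
      ext b
      simp
    simp [conv, rOp, hp0, h0]
  -- At order one `⟨λ, β⟩` is an eigenvalue and the convolution vanishes by `p 0 = 0`, so the
  -- recursion holds whatever the value of `p β`.
  · have hΔ : charFn α n (pairing l β) = 0 := by
      refine charFn_eq_zero (hD β h.ge) ?_
      rcases Nat.eq_zero_or_pos β.1 with h0 | h0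
      · have h1 : β.2 = 1 := by omega
        simpa [pairing, h0, h1] using h₂
      · have h1 : β.1 = 1 := by omega
        have h2 : β.2 = 0 := by omega
        simpa [pairing, h2, h1] using h₁
    have hconv : conv p (rOp n l p) β = 0 := by
      refine Finset.sum_eq_zero fun b hb => ?_
      rw [Finset.mem_Iic] at hb
      have hb1 := hb.1
      have hb2 := hb.2
      by_cases hb0 : b = 0
      · rw [hb0, hp0, zero_mul]
      · have : β - b = 0 := by
          have : b.1 + b.2 ≠ 0 := fun h0 => hb0 (Prod.ext (by simp; omega) (by simp; omega))
          refine Prod.ext ?_ ?_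
          · change β.1 - b.1 = 0; omega
          · change β.2 - b.2 = 0; omega
        rw [this, rOp, hp0, zero_mul, mul_zero]
    rw [hconv, rOp]
    rw [charFn] at hΔ
    linear_combination -p β * hΔ
  · have := congrFun hp β
    simp only [zeroMap, show β.1 + β.2 ≠ 0 by omega, show β.1 + β.2 ≠ 1 by omega, if_false,
      Pi.zero_apply, charFn] at this
    rw [rOp]
    linear_combination -this

/-- The invariance equation for the parametrization. -/
lemma invariance (hc : Summable fun β => ‖paramCoeff n l p β‖) {σ : ℂ × ℂ}
    (hσ : σ ∈ ball (0 : ℂ × ℂ) 1) :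
    fderiv ℂ (paramMap n l p) σ (l.1 * σ.1, l.2 * σ.2) =
      wrightCLM α n (paramMap n l p σ) + wrightNonlin α n (paramMap n l p σ) := by
  have hp0 := coeff_zero hp
  have hL := hasSum_fderiv_doubleSeries_pairing hc hσ l
  have hP := hasSum_doubleSeries hc (ball_subset_closedBall hσ)
  have hPn : Summable fun β : ℕ × ℕ => ‖(σ.1 ^ β.1 * σ.2 ^ β.2) • paramCoeff n l p β‖ :=
    hc.of_nonneg_of_le (fun _ => norm_nonneg _)
      (norm_doubleSeries_term_le _ (ball_subset_closedBall hσ))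
  rw [← paramMap_eq] at hL hP
  set Pσ := paramMap n l p σ with hPσ
  have hA := hP.mapL (wrightCLM α n)
  set x : ℕ × ℕ → ℂ := fun β => σ.1 ^ β.1 * σ.2 ^ β.2 * p β with hx
  set y : ℕ × ℕ → ℂ := fun β => σ.1 ^ β.1 * σ.2 ^ β.2 * rOp n l p β with hy
  have hx1 : HasSum x Pσ.1 := by
    have := hP.mapL (ContinuousLinearMap.fst ℂ ℂ (Fin n → ℂ))
    simpa [paramCoeff, hx] using this
  have hy1 : HasSum y (Pσ.2 (lastIdx n)) := by
    have := hP.mapL ((ContinuousLinearMap.proj (R := ℂ) (φ := fun _ : Fin n => ℂ)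
      (lastIdx n)).comp (ContinuousLinearMap.snd ℂ ℂ (Fin n → ℂ)))
    simpa [paramCoeff, hy, rOp] using this
  have hxn : Summable fun β => ‖x β‖ := hPn.of_nonneg_of_le (fun _ => norm_nonneg _) fun β => by
    simp [paramCoeff, hx]
  have hyn : Summable fun β => ‖y β‖ := hPn.of_nonneg_of_le (fun _ => norm_nonneg _) fun β => by
    have := (norm_le_pi_norm ((σ.1 ^ β.1 * σ.2 ^ β.2) • paramCoeff n l p β).2 (lastIdx n)).trans
      (norm_snd_le _)
    simpa [paramCoeff, hy, rOp] using this
  have hxy := hasSum_conv hxn hyn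
  -- Monomials are multiplicative in the exponent, so the factor `σ^β` comes out of the convolution.
  have hconv : conv x y = fun β => σ.1 ^ β.1 * σ.2 ^ β.2 * conv p (rOp n l p) β := by
    funext β
    rw [conv, conv, Finset.mul_sum]
    refine Finset.sum_congr rfl fun b hb => ?_
    rw [Finset.mem_Iic] at hb
    have e1 : σ.1 ^ β.1 = σ.1 ^ b.1 * σ.1 ^ (β - b).1 := by
      rw [← pow_add]; congr 1; exact (Nat.add_sub_cancel' hb.1).symm
    have e2 : σ.2 ^ β.2 = σ.2 ^ b.2 * σ.2 ^ (β - b).2 := by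
      rw [← pow_add]; congr 1; exact (Nat.add_sub_cancel' hb.2).symm
    rw [e1, e2]
    simp only [hx, hy]
    ring
  rw [hx1.tsum_eq, hy1.tsum_eq, hconv] at hxy
  have hcoeff := coeff_recursion h₁ h₂ hD hp
  refine Prod.ext ?_ ?_
  · have hl1 := hL.mapL (ContinuousLinearMap.fst ℂ ℂ (Fin n → ℂ))
    have hr1 := (hy1.mul_left (-(α : ℂ))).add (hxy.mul_left (-(α : ℂ)))
    have e : (fun β => ContinuousLinearMap.fst ℂ ℂ (Fin n → ℂ)
        ((pairing l β * (σ.1 ^ β.1 * σ.2 ^ β.2)) • paramCoeff n l p β)) =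
        fun β => -(α : ℂ) * y β +
          -(α : ℂ) * (σ.1 ^ β.1 * σ.2 ^ β.2 * conv p (rOp n l p) β) := by
      funext β
      simp only [paramCoeff, hy, ContinuousLinearMap.coe_fst', Prod.smul_fst, smul_eq_mul, mul_one]
      linear_combination -(σ.1 ^ β.1 * σ.2 ^ β.2) * hcoeff β
    rw [e] at hl1
    refine (hl1.unique hr1).trans ?_
    change _ = -(α : ℂ) * Pσ.2 (lastIdx n) + -(α : ℂ) * Pσ.2 (lastIdx n) * Pσ.1
    ring
  · have hl2 := hL.mapL (ContinuousLinearMap.snd ℂ ℂ (Fin n → ℂ))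
    have hr2 := hA.mapL (ContinuousLinearMap.snd ℂ ℂ (Fin n → ℂ))
    refine hl2.unique ?_
    convert hr2 using 1
    · funext β
      -- Nonresonance is assumed only for `|β| ≥ 1`; at `β = 0` the coefficient `p 0 = 0` replaces
      -- the identity for `blowup`.
      by_cases hβ : β = 0
      · simp [hβ, paramCoeff, hp0]
      · have hβ1 : 1 ≤ β.1 + β.2 := by
          by_contra hlt
          exact hβ (Prod.ext (by simp; omega) (by simp; omega))
        have e : (wrightCLM α n ((1 : ℂ), blowup n (pairing l β))).2 =
            pairing l β • blowup n (pairing l β) := by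
          change (diffMatrixOver ℂ n).mulVec _ - (1 : ℂ) • diffOne ℂ n = _
          rw [one_smul, mulVec_blowup (hD β hβ1)]
        simp only [paramCoeff, map_smul, ContinuousLinearMap.coe_snd', e]
        simp only [smul_smul]
        congr 1
        ring
    · exact add_zero _

/-- Orbits of the linear flow are mapped to solutions. -/
lemma paramMap_solution (hc : Summable fun β => ‖paramCoeff n l p β‖) {σ : ℂ × ℂ} {t : ℝ}
    (hσ : linFlow l t σ ∈ ball (0 : ℂ × ℂ) 1) :
    HasDerivAt (fun t => paramMap n l p (linFlow l t σ))
      (wrightCLM α n (paramMap n l p (linFlow l t σ)) +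
        wrightNonlin α n (paramMap n l p (linFlow l t σ))) t := by
  have hexp : ∀ z w : ℂ, HasDerivAt (fun t : ℝ => Complex.exp (z * t) * w)
      (z * (Complex.exp (z * t) * w)) t := by
    intro z w
    have h1 : HasDerivAt (fun t : ℝ => z * (t : ℂ)) z t := by
      simpa using (Complex.ofRealCLM.hasDerivAt (x := t)).const_mul z
    exact (h1.cexp.mul_const w).congr_deriv (by ring)
  have hflow : HasDerivAt (fun t => linFlow l t σ)
      (l.1 * (linFlow l t σ).1, l.2 * (linFlow l t σ).2) t :=
    (hexp l.1 σ.1).prodMk (hexp l.2 σ.2)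
  have hd : HasFDerivAt (paramMap n l p) (fderiv ℂ (paramMap n l p) (linFlow l t σ))
      (linFlow l t σ) := by
    rw [paramMap_eq]
    exact (analyticOnNhd_doubleSeries hc _ hσ).differentiableAt.hasFDerivAt
  exact ((hd.restrictScalars ℝ).comp_hasDerivAt t hflow).congr_deriv
    (invariance h₁ h₂ hD hp hc hσ)

end

/-- The map `P_n` satisfies all requirements on a parametrization of the unstable manifold. -/
lemma isUnstableParam_paramMap (hne : l.1 ≠ l.2)
    (heig : (wrightLin α n).charpoly.roots.filter (fun z : ℂ => 0 < z.re) = {l.1, l.2})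
    (hD : ∀ β : ℕ × ℕ, 1 ≤ β.1 + β.2 → pairing l β ∉ spectrum ℂ (diffMatrixOver ℂ n))
    {ξ : ℕ × ℕ → ℂ} (hξ : ∀ β : ℕ × ℕ, β.1 + β.2 = 1 → ξ β ≠ 0)
    (hp : zeroMap α n l ξ p = 0) (hsum : Summable fun β => ‖p β‖) :
    IsUnstableParam (wrightCLM α n) (wrightNonlin α n) l (stableRoots α n)
      (unstableSubspace α n) (paramMap n l p) := by
  obtain ⟨hr₁, hre₁⟩ := mem_roots_of_mem heig (Or.inl rfl)
  obtain ⟨hr₂, hre₂⟩ := mem_roots_of_mem heig (Or.inr rfl)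
  have hpair₁ : pairing l (1, 0) = l.1 := by simp [pairing]
  have hpair₂ : pairing l (0, 1) = l.2 := by simp [pairing]
  have hD₁ : l.1 ∉ spectrum ℂ (diffMatrixOver ℂ n) := by
    have := hD (1, 0) (by simp)
    rwa [hpair₁] at this
  have hD₂ : l.2 ∉ spectrum ℂ (diffMatrixOver ℂ n) := by
    have := hD (0, 1) (by simp)
    rwa [hpair₂] at this
  have hc := summable_paramCoeff hre₁ hre₂ hD hsum
  have hc0 : paramCoeff n l p 0 = 0 := by rw [paramCoeff, coeff_zero hp, zero_smul]
  have hp₁ : p (1, 0) ≠ 0 := by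
    rw [coeff_one hp (β := (1, 0)) (by simp)]; exact hξ _ (by simp)
  have hp₂ : p (0, 1) ≠ 0 := by
    rw [coeff_one hp (β := (0, 1)) (by simp)]; exact hξ _ (by simp)
  have hderiv : ∀ v : ℂ × ℂ, fderiv ℂ (paramMap n l p) 0 v =
      (v.1 * p (1, 0)) • ((1 : ℂ), blowup n l.1) + (v.2 * p (0, 1)) • ((1 : ℂ), blowup n l.2) := by
    intro v
    rw [paramMap_eq, fderiv_doubleSeries_zero hc, paramCoeff, paramCoeff, hpair₁, hpair₂,
      smul_smul, smul_smul]
  have hrange : (fderiv ℂ (paramMap n l p) 0).range = unstableSubspace α n := by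
    apply le_antisymm
    · rintro _ ⟨v, rfl⟩
      rw [unstableSubspace_eq_span hne heig hD₁ hD₂]
      exact Submodule.mem_span_pair.2 ⟨_, _, (hderiv v).symm⟩
    · intro x hx
      obtain ⟨a, b, rfl⟩ := exists_of_mem_unstableSubspace hne heig hD₁ hD₂ hx
      refine ⟨(a / p (1, 0), b / p (0, 1)), (hderiv _).trans ?_⟩
      rw [div_mul_cancel₀ _ hp₁, div_mul_cancel₀ _ hp₂]
  exact
    { re_fst_pos := hre₁
      re_snd_pos := hre₂
      re_nonpos := fun ν hν => re_nonpos_of_mem_stableRoots hν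
      aeval_eq_zero := aeval_wrightCLM_eq_zero heig
      aeval_mem := aeval_mem_unstableSubspace hne heig hD₁ hD₂
      aeval_inj := fun x hx => aeval_inj_unstableSubspace hne heig hD₁ hD₂ hx
      nonlin := ⟨|α|, abs_nonneg α, norm_wrightNonlin_sub_le⟩
      analytic := by rw [paramMap_eq]; exact analyticOnNhd_doubleSeries hc
      continuousOn := by rw [paramMap_eq]; exact continuousOn_doubleSeries hc
      bound := ⟨∑' β, ‖paramCoeff n l p β‖, tsum_nonneg fun _ => norm_nonneg _, fun σ hσ => by
        rw [paramMap_eq]; exact norm_doubleSeries_le hc hc0 hσ⟩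
      deriv_inj := by
        rw [injective_iff_map_eq_zero]
        intro v hv
        obtain ⟨e₁, e₂⟩ := eq_zero_of_smul_add_smul_eq_zero hne heig hD₁ hD₂
          ((hderiv v).symm.trans hv)
        exact Prod.ext ((mul_eq_zero.1 e₁).resolve_right hp₁)
          ((mul_eq_zero.1 e₂).resolve_right hp₂)
      range_deriv := hrange
      solution := fun σ hσ t ht => by
        refine (paramMap_solution hr₁ hr₂ hD hp hc ?_).hasDerivWithinAt
        have h1 := norm_linFlow_le (min_le_left l.1.re l.2.re) (min_le_right _ _) ht σ
        rw [mem_ball_zero_iff] at hσ ⊢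
        refine h1.trans_lt ((mul_le_of_le_one_left (norm_nonneg _) ?_).trans_lt hσ)
        rw [Real.exp_le_one_iff]
        exact mul_nonpos_of_nonneg_of_nonpos (lt_min hre₁ hre₂).le ht }

/-! ### The real structure and the two domains. -/

/-- The inclusion `ℝ × ℝⁿ → ℂ × ℂⁿ` as a continuous linear map. -/
def complexifyCLM (n : ℕ) : (ℝ × (Fin n → ℝ)) →L[ℝ] (ℂ × (Fin n → ℂ)) :=
  LinearMap.toContinuousLinearMap (complexify n)

/-- The real part `ℂ × ℂⁿ → ℝ × ℝⁿ`. -/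
def reCLM (n : ℕ) : (ℂ × (Fin n → ℂ)) →L[ℝ] (ℝ × (Fin n → ℝ)) :=
  (Complex.reCLM.comp (ContinuousLinearMap.fst ℝ ℂ (Fin n → ℂ))).prod
    (ContinuousLinearMap.pi fun i => Complex.reCLM.comp
      ((ContinuousLinearMap.proj i).comp (ContinuousLinearMap.snd ℝ ℂ (Fin n → ℂ))))

/-- All data of the field are real, and the stable eigenvalues are closed under conjugation. -/
lemma isRealStructure_wright :
    IsRealStructure (wrightCLM α n) (wrightNonlin α n)
      (aeval (wrightCLM α n) ((stableRoots α n).map (fun ν => X - C ν)).prod)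
      (wrightField ℝ α n) (conjCLM n) (complexifyCLM n) (reCLM n) where
  norm_conj := norm_conjCLM
  conj_field x := by
    rw [map_add, wrightCLM_apply, conjCLM_wrightLin, wrightCLM_apply]
    congr 1
    refine Prod.ext ?_ ?_
    · change starRingEnd ℂ (-(α : ℂ) * x.2 (lastIdx n) * x.1) =
        -(α : ℂ) * starRingEnd ℂ (x.2 (lastIdx n)) * starRingEnd ℂ x.1
      simp
    · funext i
      exact map_zero (starRingEnd ℂ)
  conj_comm x := by rw [conjCLM_aeval, stableRoots_map_conj]
  conj_coe y := Prod.ext (Complex.conj_ofReal _) (funext fun i => Complex.conj_ofReal _)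
  coe_re x hx := Prod.ext (Complex.conj_eq_iff_re.1 (congrArg Prod.fst hx))
    (funext fun i => Complex.conj_eq_iff_re.1 (congrFun (congrArg Prod.snd hx) i))
  re_coe y := rfl
  coe_field y := by
    refine Prod.ext ?_ ?_
    · change ((-α * y.2 (lastIdx n) * (1 + y.1) : ℝ) : ℂ) =
        -(α : ℂ) * (y.2 (lastIdx n) : ℂ) + -(α : ℂ) * (y.2 (lastIdx n) : ℂ) * (y.1 : ℂ)
      push_cast
      ring
    · funext i
      change (((diffMatrixOver ℝ n).mulVec y.2 i - y.1 * diffOne ℝ n i : ℝ) : ℂ) =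
        (diffMatrixOver ℂ n).mulVec (fun j => (y.2 j : ℂ)) i - (y.1 : ℂ) * diffOne ℂ n i + 0
      simp [Matrix.mulVec, dotProduct, diffOne, diffMatrixOver]

/-- Each coordinate shrinks in backward time, so the polydisk and the Euclidean ball are both
backward invariant. -/
lemma norm_exp_mul_le {z : ℂ} (hz : 0 < z.re) {t : ℝ} (ht : t ≤ 0) (w : ℂ) :
    ‖Complex.exp (z * t) * w‖ ≤ ‖w‖ := by
  rw [norm_mul, Complex.norm_exp]
  refine mul_le_of_le_one_left (norm_nonneg _) (Real.exp_le_one_iff.2 ?_)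
  simpa using mul_nonpos_of_nonneg_of_nonpos hz.le ht

lemma isUnstableDomain_polydisk (h₁ : 0 < l.1.re) (h₂ : 0 < l.2.re) :
    IsUnstableDomain l polydisk where
  isOpen := (isOpen_lt continuous_fst.norm continuous_const).inter
    (isOpen_lt continuous_snd.norm continuous_const)
  zero_mem := by simp [polydisk]
  subset σ hσ := by
    rw [mem_ball_zero_iff, Prod.norm_def]
    exact max_lt hσ.1 hσ.2
  invariant σ hσ t ht :=
    ⟨(norm_exp_mul_le h₁ ht _).trans_lt hσ.1, (norm_exp_mul_le h₂ ht _).trans_lt hσ.2⟩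

lemma isUnstableDomain_euclideanUnitBall (h₁ : 0 < l.1.re) (h₂ : 0 < l.2.re) :
    IsUnstableDomain l euclideanUnitBall where
  isOpen := isOpen_lt ((continuous_fst.norm.pow 2).add (continuous_snd.norm.pow 2))
    continuous_const
  zero_mem := by simp [euclideanUnitBall]
  subset σ hσ := by
    have hσ' : ‖σ.1‖ ^ 2 + ‖σ.2‖ ^ 2 < 1 := hσ
    rw [mem_ball_zero_iff, Prod.norm_def]
    refine max_lt ?_ ?_
    · nlinarith [norm_nonneg σ.1, sq_nonneg ‖σ.2‖]
    · nlinarith [norm_nonneg σ.2, sq_nonneg ‖σ.1‖]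
  invariant σ hσ t ht := by
    have hσ' : ‖σ.1‖ ^ 2 + ‖σ.2‖ ^ 2 < 1 := hσ
    refine lt_of_le_of_lt ?_ hσ'
    rw [linFlow_apply]
    gcongr
    · exact norm_exp_mul_le h₁ ht _
    · exact norm_exp_mul_le h₂ ht _

end Wright

end

theorem mainTheorem5 (n : ℕ) [NeZero n] (α : ℝ) (hα : 0 < α)
    (l : ℂ × ℂ) (hne : l.1 ≠ l.2)
    (heig : (wrightLin α n).charpoly.roots.filter (fun z : ℂ => 0 < z.re) = {l.1, l.2})
    (hD : ∀ β : ℕ × ℕ, 1 ≤ β.1 + β.2 → pairing l β ∉ spectrum ℂ (diffMatrixOver ℂ n))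
    (ξ : ℕ × ℕ → ℂ) (hξ : ∀ β : ℕ × ℕ, β.1 + β.2 = 1 → ξ β ≠ 0)
    (p : ℕ × ℕ → ℂ) (hp : zeroMap α n l ξ p = 0) (hsum : Summable fun β => ‖p β‖) :
    (∀ σ : ℂ × ℂ, ‖σ.1‖ ≤ 1 → ‖σ.2‖ ≤ 1 → Summable fun β => ‖paramTerm n l p σ β‖) ∧
    ∀ B : Set (ℂ × ℂ), B = polydisk ∨ B = euclideanUnitBall →
      IsAnalyticParametrization ℂ (paramMap n l p) B (paramMap n l p '' B) ∧
      paramMap n l p 0 = 0 ∧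
      (fderiv ℂ (paramMap n l p) 0).range = unstableSubspace α n ∧
      IsLocalUnstableManifold ℂ (wrightField ℂ α n) (unstableSubspace α n)
        (paramMap n l p '' B) ∧
      IsLocalUnstableManifold ℝ (wrightField ℝ α n) (realUnstableSubspace α n)
        (complexify n ⁻¹' (paramMap n l p '' B)) := by
  have h := isUnstableParam_paramMap hne heig hD hξ hp hsum
  refine ⟨fun σ h₁ h₂ => ?_, fun B hB => ?_⟩
  · have hc := summable_paramCoeff h.re_fst_pos h.re_snd_pos hD hsum
    refine hc.of_nonneg_of_le (fun _ => norm_nonneg _) fun β => ?_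
    rw [paramTerm_eq]
    exact norm_doubleSeries_term_le _ (by
      rw [mem_closedBall_zero_iff, Prod.norm_def]; exact max_le h₁ h₂) β
  · have hdom : IsUnstableDomain l B := by
      rcases hB with rfl | rfl
      · exact isUnstableDomain_polydisk h.re_fst_pos h.re_snd_pos
      · exact isUnstableDomain_euclideanUnitBall h.re_fst_pos h.re_snd_pos
    refine ⟨h.isAnalyticParametrization hdom.isOpen hdom.subset, h.apply_zero, h.range_deriv,
      ?_, ?_⟩
    · rw [wrightField_eq]
      exact h.isLocalUnstableManifold hdom
    · exact h.isLocalUnstableManifold_real isRealStructure_wright hdom fun y => Iff.rfl
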